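/- Let $X$ be a second-countable Peano continuum (a non-empty, compact, connected, locally connected, second-countable Hausdorff space) and let $f : X \to \mathbb{R}$ be continuous. A contour of $f$ is a connected component of a non-empty level set $f^{-1}(t)$. The Reeb space $W_f$ is the quotient space of $X$ in which two points are identified exactly when they lie in the same contour, and $q_f : X \to W_f$ is the quotient map. A set $A \subset X$ is saturated if it is a union of contours, that is, $q_f^{-1}(q_f(A)) = A$. A non-empty, open, connected and saturated set $U \subset X$ is called cylindrical if for every $z \in q_f(U)$ the set $U \setminus q_f^{-1}(z)$ has exactly two connected components. An open, connected and saturated set $U \subset X$ is called star-like with respect to a contour $L \subset U$ if $U \setminus L$ is a disjoint union of finitely many (possibly zero) cylindrical sets, and star-like if it is star-like with respect to some contour $L \subset U$. A space has the structure of a finite graph if it is homeomorphic to the space obtained from a finite discrete set of vertices by attaching the end points of finitely many copies of $[0,1]$ (multiple edges, loops and single vertices without edges are allowed). Then $W_f$ has the structure of a finite graph if and only if every contour of $f$ is contained in a star-like open set. Equivalently, $W_f$ has the structure of a finite graph if and only if every contour $C$ of $f$ has an open neighborhood that is star-like with respect to $C$ itself. -/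

import Mathlib

/-- Two points are Reeb equivalent for `f` when they have the same value and lie in the same
connected component of the corresponding level set. -/
def reebSetoid {X Y : Type*} [TopologicalSpace X] (f : X → Y) : Setoid X where
  r x y := f x = f y ∧ y ∈ connectedComponentIn (f ⁻¹' {f x}) x
  iseqv :=
    { refl := fun x => ⟨rfl, mem_connectedComponentIn rfl⟩
      symm := by
        rintro x y ⟨h, hy⟩
        refine ⟨h.symm, ?_⟩
        rw [← h, ← connectedComponentIn_eq hy]
        exact mem_connectedComponentIn rfl
      trans := by
        rintro x y z ⟨h, hy⟩ ⟨h', hz⟩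
        refine ⟨h.trans h', ?_⟩
        rw [connectedComponentIn_eq hy, h]
        exact hz }

/-- The Reeb space `W_f`, with the quotient topology. -/
abbrev ReebSpace {X Y : Type*} [TopologicalSpace X] (f : X → Y) : Type _ :=
  Quotient (reebSetoid f)

/-- The quotient map `q_f : X → W_f`. -/
def reebMk {X Y : Type*} [TopologicalSpace X] (f : X → Y) (x : X) : ReebSpace f :=
  Quotient.mk (reebSetoid f) x

/-- A contour of `f`: a connected component of a (non-empty) level set. -/
def IsContour {X Y : Type*} [TopologicalSpace X] (f : X → Y) (C : Set X) : Prop :=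
  ∃ x : X, C = connectedComponentIn (f ⁻¹' {f x}) x

/-- A saturated set: a union of contours. -/
def IsReebSaturated {X Y : Type*} [TopologicalSpace X] (f : X → Y) (A : Set X) : Prop :=
  reebMk f ⁻¹' (reebMk f '' A) = A

/-- A non-empty open connected saturated set `U` such that removing any single contour
`q_f⁻¹(z)`, `z ∈ q_f(U)`, leaves exactly two connected components.
(`IsConnected` includes non-emptiness.) -/
structure IsCylindrical {X Y : Type*} [TopologicalSpace X] (f : X → Y) (U : Set X) : Prop where
  isOpen : IsOpen U
  isConnected : IsConnected U
  saturated : IsReebSaturated f U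
  two_components : ∀ z ∈ reebMk f '' U,
    Nat.card (ConnectedComponents ↥(U \ reebMk f ⁻¹' {z})) = 2

/-- `U` is star-like with respect to the contour `L ⊆ U`: it is open, connected and saturated,
and `U \ L` is a disjoint union of finitely many (possibly zero) cylindrical sets. -/
structure IsStarLikeAbout {X Y : Type*} [TopologicalSpace X] (f : X → Y) (L U : Set X) :
    Prop where
  isOpen : IsOpen U
  isConnected : IsConnected U
  saturated : IsReebSaturated f U
  isContour : IsContour f L
  subset : L ⊆ U
  diff_eq : ∃ 𝒱 : Set (Set X), 𝒱.Finite ∧ (∀ V ∈ 𝒱, IsCylindrical f V) ∧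
    𝒱.PairwiseDisjoint id ∧ U \ L = ⋃₀ 𝒱

/-- `U` is star-like: it is star-like with respect to some contour contained in it. -/
def IsStarLike {X Y : Type*} [TopologicalSpace X] (f : X → Y) (U : Set X) : Prop :=
  ∃ L : Set X, IsStarLikeAbout f L U

/-- A finite multigraph: finitely many vertices and finitely many edges, each edge with two
(arbitrarily ordered) end vertices. Multiple edges, loops and isolated vertices are allowed. -/
structure FiniteMultigraph where
  numVertices : ℕ
  numEdges : ℕ
  src : Fin numEdges → Fin numVertices
  tgt : Fin numEdges → Fin numVertices

namespace FiniteMultigraph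

/-- The disjoint union of the (discrete) vertex set and one copy of `[0, 1]` for each edge. -/
abbrev Pieces (G : FiniteMultigraph) : Type :=
  Fin G.numVertices ⊕ (Fin G.numEdges × unitInterval)

/-- The end points of every edge are attached to the end vertices. -/
inductive Glue (G : FiniteMultigraph) : G.Pieces → G.Pieces → Prop
  | src (e : Fin G.numEdges) : Glue G (Sum.inr (e, 0)) (Sum.inl (G.src e))
  | tgt (e : Fin G.numEdges) : Glue G (Sum.inr (e, 1)) (Sum.inl (G.tgt e))

/-- The topological realization: the finite CW complex of dimension at most one obtained by
attaching the edges to the vertices, with the quotient topology. -/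
abbrev Realization (G : FiniteMultigraph) : Type :=
  Quot G.Glue

end FiniteMultigraph

/-- A space has the structure of a finite graph if it is homeomorphic to the realization of a
finite multigraph. -/
def HasFiniteGraphStructure (W : Type*) [TopologicalSpace W] : Prop :=
  ∃ G : FiniteMultigraph, Nonempty (W ≃ₜ G.Realization)

/-!
Write `W` for the Reeb space of `f`. The quotient map `X → W` has connected fibres, so connected
open sets, and splittings of open sets in two connected open pieces, correspond to each other under
it, and `W` is a compact, locally connected, separable Hausdorff space (`t2Space_reebSpace`).
Cylindrical sets become connected open sets in which the complement of each point splits in two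
(`IsCylinder`), and the theorem becomes a statement about `W` alone.

The main step is that such a set `V` is an open arc whose two ends converge in `W`
(`IsCylinder.exists_isOpenArc`). First, `V` is homeomorphic to the line
(`nonempty_homeomorph_real_of_splitsInTwo`). Among any three points one separates the other two
(`not_triod`): otherwise the sides of cut points that contain at most one of the three form a
laminar family, their maximal members partition `V`, and the set of base points of these members is
closed, countable by separability, and without isolated points, against Baire's theorem. Hence left
and right sides of all points can be chosen consistently; the resulting linear order induces the
topology, and a separable connected order without end points is the line. Second, local
connectedness of `W` forces the ends of the line to converge.

If star-like sets cover `X`, finitely many of them do, so `W` is the union of finitely many points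
and finitely many open arcs. Open arcs have finite boundary, and cutting all arcs at all boundary
points and centres gives finitely many arcs that are pairwise disjoint, because two of them that
meet are equal, each being relatively closed off the vertices (`exists_isArcDecomposition`).
Parametrizing these arcs maps the realization of a finite multigraph onto `W` homeomorphically.
Conversely, a finite graph can be subdivided at any given point `w`, and `w` with the open edges
ending at it is a star.
-/

open Set Topology Filter

/-! ### Connected components and the Reeb quotient -/

/-- A set splits in two when it is the disjoint union of two connected open sets. For open sets of
a locally connected space this says that the set has exactly two connected components. -/
def SplitsInTwo {X : Type*} [TopologicalSpace X] (O : Set X) : Prop :=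
  ∃ A B : Set X, IsOpen A ∧ IsOpen B ∧ IsConnected A ∧ IsConnected B ∧ Disjoint A B ∧ A ∪ B = O

theorem SplitsInTwo.card_connectedComponents {X : Type*} [TopologicalSpace X] {O : Set X}
    (h : SplitsInTwo O) : Nat.card (ConnectedComponents O) = 2 := by
  obtain ⟨A, B, hA, hB, hAc, hBc, hd, rfl⟩ := h
  let S : Bool → Set X := fun b => cond b A B
  have hSo : ∀ b, IsOpen (S b) := by rintro (_ | _) <;> assumption
  have hSsub : ∀ b, S b ⊆ A ∪ B := by
    rintro (_ | _)
    exacts [subset_union_right, subset_union_left]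
  let U : Bool → Set ↥(A ∪ B) := fun b => Subtype.val ⁻¹' S b
  have hUo : ∀ b, IsOpen (U b) := fun b => (hSo b).preimage continuous_subtype_val
  have hcompl : ∀ b, (U b)ᶜ = U (!b) := by
    intro b
    ext ⟨x, hx⟩
    have hx' := hd.notMem_of_mem_left (a := x)
    rcases b with _ | _ <;> simp only [U, S, mem_compl_iff, mem_preimage] <;>
      simp <;> rcases hx with hx | hx <;> tauto
  have e := ConnectedComponents.equivOfIsClopenOfIsConnected (U := U)
    (fun b => ⟨⟨by rw [hcompl]; exact hUo _⟩, hUo b⟩) ?_ ?_ ?_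
  · rw [Nat.card_congr e]
    simp
  · intro b c hbc
    obtain rfl : c = !b := by cases b <;> cases c <;> simp_all
    simpa only [Function.onFun, ← hcompl] using disjoint_compl_right
  · ext ⟨x, hx⟩
    simp only [mem_iUnion, mem_univ, iff_true]
    rcases hx with hx | hx
    exacts [⟨true, hx⟩, ⟨false, hx⟩]
  · intro b
    have hc : IsConnected (S b) := by cases b <;> assumption
    have := IsInducing.subtypeVal.isPreconnected_image (s := U b)
    rw [Subtype.image_preimage_coe, inter_eq_right.2 (hSsub b)] at this
    refine ⟨?_, this.1 hc.2⟩
    obtain ⟨x, hx⟩ := hc.1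
    exact ⟨⟨x, hSsub b hx⟩, hx⟩

theorem splitsInTwo_of_card_connectedComponents {X : Type*} [TopologicalSpace X]
    [LocallyConnectedSpace X] {O : Set X} (hO : IsOpen O)
    (h : Nat.card (ConnectedComponents O) = 2) : SplitsInTwo O := by
  have := hO.locallyConnectedSpace
  obtain ⟨a, b, hab, huniv⟩ := Nat.card_eq_two_iff.1 h
  obtain ⟨x, rfl⟩ := ConnectedComponents.surjective_coe a
  obtain ⟨y, rfl⟩ := ConnectedComponents.surjective_coe b
  refine ⟨Subtype.val '' connectedComponent x, Subtype.val '' connectedComponent y,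
    hO.isOpenMap_subtype_val _ isOpen_connectedComponent,
    hO.isOpenMap_subtype_val _ isOpen_connectedComponent,
    isConnected_connectedComponent.image _ continuous_subtype_val.continuousOn,
    isConnected_connectedComponent.image _ continuous_subtype_val.continuousOn, ?_, ?_⟩
  · rw [disjoint_image_iff Subtype.val_injective]
    exact connectedComponent_disjoint (ConnectedComponents.coe_ne_coe.1 hab)
  · rw [← image_union]
    have : connectedComponent x ∪ connectedComponent y = univ := by
      refine eq_univ_of_forall fun z => ?_
      have hz : (z : ConnectedComponents O) ∈ ({(x : ConnectedComponents O), ↑y} : Set _) :=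
        huniv ▸ mem_univ _
      rcases hz with hz | hz
      · exact Or.inl (ConnectedComponents.coe_eq_coe'.1 hz)
      · exact Or.inr (ConnectedComponents.coe_eq_coe'.1 hz)
    rw [this, image_univ, Subtype.range_coe]

theorem Topology.IsQuotientMap.isPreconnected_preimage_of_isOpen {X Y : Type*} [TopologicalSpace X]
    [TopologicalSpace Y] {q : X → Y} (hq : IsQuotientMap q)
    (hfib : ∀ y, IsPreconnected (q ⁻¹' {y})) {V : Set Y} (hV : IsOpen V) (hVc : IsPreconnected V) :
    IsPreconnected (q ⁻¹' V) := by
  rw [isPreconnected_iff_subset_of_disjoint]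
  intro u v hu hv huv hdis
  have hO := hV.preimage hq.continuous
  -- A fibre inside `q ⁻¹' V` is contained in `u` or in `v`, so both traces are saturated.
  have key : ∀ x ∈ q ⁻¹' V, ∀ x' ∈ q ⁻¹' V, q x = q x' → x ∈ u → x' ∈ u := by
    intro x hx x' hx' h hxu
    have hsub : q ⁻¹' {q x} ⊆ q ⁻¹' V := by
      intro z hz
      rw [mem_preimage, mem_singleton_iff] at hz
      rw [mem_preimage, hz]
      exact hx
    rcases isPreconnected_iff_subset_of_disjoint.1 (hfib (q x)) u v hu hv (hsub.trans huv)
      (subset_eq_empty (inter_subset_inter_left _ hsub) hdis) with h1 | h1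
    · exact h1 h.symm
    · exact absurd hdis (Nonempty.ne_empty ⟨x, hx, hxu, h1 rfl⟩)
  have key' : ∀ x ∈ q ⁻¹' V, ∀ x' ∈ q ⁻¹' V, q x = q x' → x ∈ v → x' ∈ v := by
    intro x hx x' hx' h hxv
    rcases huv hx' with h1 | h1
    · exact absurd hdis (Nonempty.ne_empty ⟨x, hx, key x' hx' x hx h.symm h1, hxv⟩)
    · exact h1
  have hopen : ∀ w : Set X, IsOpen w →
      (∀ x ∈ q ⁻¹' V, ∀ x' ∈ q ⁻¹' V, q x = q x' → x ∈ w → x' ∈ w) →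
      IsOpen (q '' (q ⁻¹' V ∩ w)) := by
    intro w hw hsat
    rw [← hq.isOpen_preimage]
    convert hO.inter hw using 1
    ext x
    constructor
    · rintro ⟨x', ⟨hx', hw'⟩, h⟩
      have hx : x ∈ q ⁻¹' V := by rw [mem_preimage, ← h]; exact hx'
      exact ⟨hx, hsat x' hx' x hx h hw'⟩
    · exact fun hx => ⟨x, hx, rfl⟩
  have hcov : V ⊆ q '' (q ⁻¹' V ∩ u) ∪ q '' (q ⁻¹' V ∩ v) := by
    intro y hy
    obtain ⟨x, rfl⟩ := hq.surjective y
    rcases huv hy with h1 | h1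
    exacts [Or.inl ⟨x, ⟨hy, h1⟩, rfl⟩, Or.inr ⟨x, ⟨hy, h1⟩, rfl⟩]
  have hdis' : V ∩ (q '' (q ⁻¹' V ∩ u) ∩ q '' (q ⁻¹' V ∩ v)) = ∅ := by
    rw [eq_empty_iff_forall_notMem]
    rintro _ ⟨-, ⟨x, ⟨hx, hxu⟩, rfl⟩, ⟨x', ⟨hx', hxv⟩, h⟩⟩
    exact absurd hdis (Nonempty.ne_empty ⟨x, hx, hxu, key' x' hx' x hx h hxv⟩)
  rcases isPreconnected_iff_subset_of_disjoint.1 hVc _ _ (hopen u hu key) (hopen v hv key')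
    hcov hdis' with h1 | h1
  · left
    intro x hx
    obtain ⟨x', ⟨hx', hw'⟩, h⟩ := h1 hx
    exact key x' hx' x hx h hw'
  · right
    intro x hx
    obtain ⟨x', ⟨hx', hw'⟩, h⟩ := h1 hx
    exact key' x' hx' x hx h hw'

section Reeb

variable {X : Type*} [TopologicalSpace X] {f : X → ℝ}

theorem isQuotientMap_reebMk : IsQuotientMap (reebMk f) := isQuotientMap_quotient_mk'

theorem reebMk_eq_iff {x y : X} :
    reebMk f x = reebMk f y ↔ f x = f y ∧ y ∈ connectedComponentIn (f ⁻¹' {f x}) x :=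
  Quotient.eq (r := reebSetoid f)

theorem reebMk_preimage_singleton (x : X) :
    reebMk f ⁻¹' {reebMk f x} = connectedComponentIn (f ⁻¹' {f x}) x := by
  ext y
  rw [mem_preimage, mem_singleton_iff, eq_comm, reebMk_eq_iff]
  refine ⟨fun h => h.2, fun h => ⟨?_, h⟩⟩
  have h' : y ∈ f ⁻¹' {f x} := connectedComponentIn_subset _ _ h
  exact Eq.symm h'

theorem isContour_iff {C : Set X} : IsContour f C ↔ ∃ w : ReebSpace f, C = reebMk f ⁻¹' {w} := by
  constructor
  · rintro ⟨x, rfl⟩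
    exact ⟨reebMk f x, (reebMk_preimage_singleton x).symm⟩
  · rintro ⟨w, rfl⟩
    obtain ⟨x, rfl⟩ := isQuotientMap_reebMk.surjective w
    exact ⟨x, reebMk_preimage_singleton x⟩

theorem isConnected_reebMk_fiber (w : ReebSpace f) : IsConnected (reebMk f ⁻¹' {w}) := by
  obtain ⟨x, rfl⟩ := isQuotientMap_reebMk.surjective w
  rw [reebMk_preimage_singleton, isConnected_connectedComponentIn_iff]
  rfl

theorem isReebSaturated_preimage (V : Set (ReebSpace f)) :
    IsReebSaturated f (reebMk f ⁻¹' V) := by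
  rw [IsReebSaturated, image_preimage_eq _ isQuotientMap_reebMk.surjective]

theorem IsReebSaturated.exists_eq_preimage {U : Set X} (h : IsReebSaturated f U) :
    ∃ V : Set (ReebSpace f), U = reebMk f ⁻¹' V := ⟨_, h.symm⟩

theorem isConnected_reebMk_preimage {V : Set (ReebSpace f)} (hV : IsOpen V) :
    IsConnected (reebMk f ⁻¹' V) ↔ IsConnected V := by
  constructor
  · intro h
    rw [← image_preimage_eq V isQuotientMap_reebMk.surjective]
    exact h.image _ isQuotientMap_reebMk.continuous.continuousOn
  · intro h
    exact ⟨h.1.preimage isQuotientMap_reebMk.surjective,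
      isQuotientMap_reebMk.isPreconnected_preimage_of_isOpen
        (fun w => (isConnected_reebMk_fiber w).2) hV h.2⟩

theorem isOpen_reebMk_preimage {V : Set (ReebSpace f)} :
    IsOpen (reebMk f ⁻¹' V) ↔ IsOpen V := isQuotientMap_reebMk.isOpen_preimage

theorem splitsInTwo_reebMk_preimage {V : Set (ReebSpace f)} :
    SplitsInTwo (reebMk f ⁻¹' V) ↔ SplitsInTwo V := by
  constructor
  · rintro ⟨A, B, hA, hB, hAc, hBc, hd, hAB⟩
    -- Contours inside `A ∪ B` lie on one side, so both sides are saturated.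
    have hside : ∀ P Q : Set X, IsOpen P → IsOpen Q → Disjoint P Q → P ∪ Q = reebMk f ⁻¹' V →
        P = reebMk f ⁻¹' (reebMk f '' P) := by
      intro P Q hP hQ hPQ hPQV
      refine Subset.antisymm (subset_preimage_image _ _) ?_
      rintro x ⟨y, hy, hxy⟩
      have hsub : reebMk f ⁻¹' {reebMk f y} ⊆ P ∪ Q := by
        rw [hPQV]
        intro z hz
        rw [mem_preimage, mem_singleton_iff] at hz
        rw [mem_preimage, hz]
        exact (hPQV ▸ Or.inl hy : y ∈ reebMk f ⁻¹' V)
      exact (isConnected_reebMk_fiber (reebMk f y)).2.subset_left_of_subset_union hP hQ hPQ hsub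
        ⟨y, rfl, hy⟩ hxy.symm
    have hA' := hside A B hA hB hd hAB
    have hB' := hside B A hB hA hd.symm (by rw [union_comm, hAB])
    have hAo : IsOpen (reebMk f '' A) := isOpen_reebMk_preimage.1 (hA' ▸ hA)
    have hBo : IsOpen (reebMk f '' B) := isOpen_reebMk_preimage.1 (hB' ▸ hB)
    refine ⟨reebMk f '' A, reebMk f '' B, hAo, hBo,
      hAc.image _ isQuotientMap_reebMk.continuous.continuousOn,
      hBc.image _ isQuotientMap_reebMk.continuous.continuousOn, ?_, ?_⟩
    · rw [disjoint_left]
      rintro _ ⟨a, ha, rfl⟩ hb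
      exact disjoint_left.1 hd ha (hB' ▸ hb)
    · rw [← image_union, hAB, image_preimage_eq _ isQuotientMap_reebMk.surjective]
  · rintro ⟨A, B, hA, hB, hAc, hBc, hd, rfl⟩
    exact ⟨reebMk f ⁻¹' A, reebMk f ⁻¹' B, isOpen_reebMk_preimage.2 hA,
      isOpen_reebMk_preimage.2 hB, (isConnected_reebMk_preimage hA).2 hAc,
      (isConnected_reebMk_preimage hB).2 hBc, hd.preimage _, preimage_union.symm⟩

/-- Contours of a continuous function on a compact Hausdorff space are separated by saturated open
sets: two contours of the same level are separated by a clopen partition of that level, and the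
partition extends to all nearby levels by compactness. -/
theorem t2Space_reebSpace [CompactSpace X] [T2Space X] (hf : Continuous f) :
    T2Space (ReebSpace f) := by
  have hg : Continuous (Quotient.lift f (fun _ _ h => h.1) : ReebSpace f → ℝ) :=
    hf.quotient_lift _
  refine ⟨fun w w' hne => ?_⟩
  obtain ⟨x, rfl⟩ := isQuotientMap_reebMk.surjective w
  obtain ⟨y, rfl⟩ := isQuotientMap_reebMk.surjective w'
  by_cases hxy : f x = f y
  swap
  · obtain ⟨u, v, hu, hv, hxu, hyv, huv⟩ := t2_separation hxy
    exact ⟨_, _, hu.preimage hg, hv.preimage hg, hxu, hyv, huv.preimage _⟩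
  set F : Set X := f ⁻¹' {f x}
  have hFcl : IsClosed F := isClosed_singleton.preimage hf
  have hyc : y ∉ connectedComponentIn F x := fun h => hne (reebMk_eq_iff.2 ⟨hxy, h⟩)
  have hxF : x ∈ F := rfl
  have hyF : y ∈ F := hxy.symm
  have : CompactSpace F := isCompact_iff_compactSpace.1 hFcl.isCompact
  rw [connectedComponentIn_eq_image hxF] at hyc
  have hyc' : (⟨y, hyF⟩ : F) ∉ connectedComponent (⟨x, hxF⟩ : F) := fun h => hyc ⟨_, h, rfl⟩
  rw [connectedComponent_eq_iInter_isClopen, mem_iInter] at hyc'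
  push Not at hyc'
  obtain ⟨⟨s, hs, hxs⟩, hys⟩ := hyc'
  simp only at hys
  have hc1 : IsClosed (Subtype.val '' s) := hFcl.isClosedMap_subtype_val s hs.1
  have hc2 : IsClosed (Subtype.val '' sᶜ) := hFcl.isClosedMap_subtype_val _ hs.compl.1
  have hdis : Disjoint (Subtype.val '' s) (Subtype.val '' sᶜ) :=
    (disjoint_image_iff Subtype.val_injective).2 disjoint_compl_right
  obtain ⟨u, v, hu, hv, hsu, hsv, huv⟩ := normal_separation hc1 hc2 hdis
  have hFuv : F ⊆ u ∪ v := by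
    intro z hz
    by_cases hzs : (⟨z, hz⟩ : F) ∈ s
    · exact Or.inl (hsu ⟨_, hzs, rfl⟩)
    · exact Or.inr (hsv ⟨_, hzs, rfl⟩)
  -- By compactness all levels in some neighbourhood `N` of the given one lie in `u ∪ v`.
  have hfc : IsClosed (f '' (u ∪ v)ᶜ) := ((hu.union hv).isClosed_compl.isCompact.image hf).isClosed
  set N : Set ℝ := (f '' (u ∪ v)ᶜ)ᶜ
  have hNo : IsOpen N := hfc.isOpen_compl
  have hxN : f x ∈ N := by
    rintro ⟨z, hz, hzx⟩
    exact hz (hFuv hzx)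
  have hNuv : f ⁻¹' N ⊆ u ∪ v := by
    intro z hz
    by_contra hzu
    exact hz ⟨z, hzu, rfl⟩
  have hsat : ∀ P Q : Set X, IsOpen P → IsOpen Q → Disjoint P Q → f ⁻¹' N ⊆ P ∪ Q →
      f ⁻¹' N ∩ P = reebMk f ⁻¹' (reebMk f '' (f ⁻¹' N ∩ P)) := by
    intro P Q hP hQ hPQ hsub
    refine Subset.antisymm (subset_preimage_image _ _) ?_
    rintro a ⟨b, ⟨hbN, hbP⟩, hab⟩
    have hfab : f b = f a := (reebMk_eq_iff.1 hab).1
    have hfib : reebMk f ⁻¹' {reebMk f b} ⊆ P ∪ Q := by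
      intro z hz
      apply hsub
      have : f z = f b := (reebMk_eq_iff.1 hz).1
      rw [mem_preimage, this]
      exact hbN
    refine ⟨?_, (isConnected_reebMk_fiber (reebMk f b)).2.subset_left_of_subset_union hP hQ hPQ
      hfib ⟨b, rfl, hbP⟩ hab.symm⟩
    rw [mem_preimage, ← hfab]
    exact hbN
  have h1 := hsat u v hu hv huv hNuv
  have h2 := hsat v u hv hu huv.symm (by rwa [union_comm])
  have hNo' := hNo.preimage hf
  refine ⟨reebMk f '' (f ⁻¹' N ∩ u), reebMk f '' (f ⁻¹' N ∩ v), ?_, ?_, ?_, ?_, ?_⟩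
  · exact isOpen_reebMk_preimage.1 (h1 ▸ hNo'.inter hu)
  · exact isOpen_reebMk_preimage.1 (h2 ▸ hNo'.inter hv)
  · exact ⟨x, ⟨hxN, hsu ⟨_, hxs, rfl⟩⟩, rfl⟩
  · exact ⟨y, ⟨by rw [mem_preimage, ← hxy]; exact hxN, hsv ⟨_, hys, rfl⟩⟩, rfl⟩
  · rw [disjoint_left]
    rintro _ ⟨a, ⟨haN, hau⟩, rfl⟩ hb
    have : a ∈ f ⁻¹' N ∩ v := by rw [h2]; exact hb
    exact disjoint_left.1 huv hau this.2

/-- The counterpart of a cylindrical set in the quotient: a connected open set in which the complement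
of every point has exactly two components. -/
structure IsCylinder {W : Type*} [TopologicalSpace W] (V : Set W) : Prop where
  isOpen : IsOpen V
  isConnected : IsConnected V
  splitsInTwo : ∀ z ∈ V, SplitsInTwo (V \ {z})

theorem isCylindrical_reebMk_preimage [LocallyConnectedSpace X] [T1Space (ReebSpace f)]
    {V : Set (ReebSpace f)} : IsCylindrical f (reebMk f ⁻¹' V) ↔ IsCylinder V := by
  have hi := image_preimage_eq V (isQuotientMap_reebMk (f := f)).surjective
  constructor
  · intro h
    have ho := isOpen_reebMk_preimage.1 h.isOpen
    refine ⟨ho, (isConnected_reebMk_preimage ho).1 h.isConnected, fun z hz => ?_⟩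
    rw [← splitsInTwo_reebMk_preimage]
    apply splitsInTwo_of_card_connectedComponents
    · exact isOpen_reebMk_preimage.2 (ho.sdiff isClosed_singleton)
    · exact h.two_components z (hi.symm ▸ hz)
  · intro h
    refine ⟨isOpen_reebMk_preimage.2 h.isOpen,
      (isConnected_reebMk_preimage h.isOpen).2 h.isConnected, isReebSaturated_preimage V, ?_⟩
    intro z hz
    rw [hi] at hz
    exact (splitsInTwo_reebMk_preimage.2 (h.splitsInTwo z hz)).card_connectedComponents

end Reeb

/-! ### Cut points -/

section CutPoints

variable {V : Type*} [TopologicalSpace V]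

/-- `A` and `B` are the two sides of the cut point `m`: disjoint connected open sets whose union is
the complement of `m`. -/
structure IsCut (m : V) (A B : Set V) : Prop where
  isOpen_left : IsOpen A
  isOpen_right : IsOpen B
  isConnected_left : IsConnected A
  isConnected_right : IsConnected B
  disjoint : Disjoint A B
  union_eq : A ∪ B = {m}ᶜ

namespace IsCut

variable {m : V} {A B : Set V}

theorem symm (h : IsCut m A B) : IsCut m B A :=
  ⟨h.2, h.1, h.4, h.3, h.disjoint.symm, by rw [union_comm, h.union_eq]⟩

theorem notMem_left (h : IsCut m A B) : m ∉ A := fun hm =>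
  (h.union_eq ▸ Or.inl hm : m ∈ ({m}ᶜ : Set V)) rfl

theorem notMem_right (h : IsCut m A B) : m ∉ B := h.symm.notMem_left

theorem mem_or (h : IsCut m A B) {x : V} (hx : x ≠ m) : x ∈ A ∨ x ∈ B := by
  have : x ∈ A ∪ B := h.union_eq ▸ hx
  exact this

theorem compl_left (h : IsCut m A B) : Aᶜ = insert m B := by
  ext x
  rw [mem_compl_iff, mem_insert_iff]
  constructor
  · intro hx
    by_cases hxm : x = m
    · exact Or.inl hxm
    · exact Or.inr ((h.mem_or hxm).resolve_left hx)
  · rintro (rfl | hx)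
    · exact h.notMem_left
    · exact fun hA => disjoint_left.1 h.disjoint hA hx

theorem isClosed_insert_right (h : IsCut m A B) : IsClosed (insert m B) :=
  h.compl_left ▸ h.isOpen_left.isClosed_compl

theorem mem_closure_right [PreconnectedSpace V] (h : IsCut m A B) : m ∈ closure B := by
  by_contra hm
  have hcl : IsClosed B := by
    rw [← closure_subset_iff_isClosed]
    intro x hx
    rcases closure_minimal (subset_insert m B) h.isClosed_insert_right hx with rfl | hx'
    exacts [absurd hx hm, hx']
  have := IsClopen.eq_univ ⟨hcl, h.isOpen_right⟩ h.isConnected_right.nonempty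
  exact h.notMem_right (this ▸ mem_univ m)

theorem isPreconnected_compl_left [PreconnectedSpace V] (h : IsCut m A B) :
    IsPreconnected Aᶜ := by
  rw [h.compl_left]
  exact h.isConnected_right.isPreconnected.subset_closure (subset_insert m B)
    (insert_subset h.mem_closure_right subset_closure)

/-- A connected set avoiding the cut point lies on the side that it meets. -/
theorem subset_left (h : IsCut m A B) {O : Set V} (hO : IsPreconnected O) (hm : m ∉ O)
    {x : V} (hxO : x ∈ O) (hxA : x ∈ A) : O ⊆ A := by
  refine hO.subset_left_of_subset_union h.isOpen_left h.isOpen_right h.disjoint ?_ ⟨x, hxO, hxA⟩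
  rw [h.union_eq]
  rintro z hz rfl
  exact hm hz

theorem subset_right (h : IsCut m A B) {O : Set V} (hO : IsPreconnected O) (hm : m ∉ O)
    {x : V} (hxO : x ∈ O) (hxB : x ∈ B) : O ⊆ B := h.symm.subset_left hO hm hxO hxB

end IsCut

/-- In a separable connected, locally connected, locally compact space whose points all are cut
points, no set `T` can have at least two, and all but at most one, of its points on one side `C m`
of every cut point `m`. Otherwise the closed small sides `(C m)ᶜ` form a laminar family, each of them
lies in a maximal one, and the maximal ones partition the space. The set of their base points is
closed, it is countable by separability, hence has an isolated point by Baire's theorem; but a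
small connected neighbourhood of this point meets other maximal sides, thus contains their base
points. -/
theorem not_forall_isCut_almost_all [ConnectedSpace V] [LocallyConnectedSpace V] [T2Space V]
    [LocallyCompactSpace V] [TopologicalSpace.SeparableSpace V] {C D : V → Set V}
    (hcut : ∀ m, IsCut m (C m) (D m)) {T : Set V} (hT : ∀ m, (C m ∩ T).Nontrivial)
    (hT' : ∀ m, (T \ C m).Subsingleton) : False := by
  have hmeet : ∀ m m', (C m ∩ C m').Nonempty := by
    intro m m'
    obtain ⟨a, ha, b, hb, hab⟩ := hT m
    by_cases ha' : a ∈ C m'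
    · exact ⟨a, ha.1, ha'⟩
    · by_cases hb' : b ∈ C m'
      · exact ⟨b, hb.1, hb'⟩
      · exact absurd (hT' m' ⟨ha.2, ha'⟩ ⟨hb.2, hb'⟩) hab
  set K : V → Set V := fun m => (C m)ᶜ
  have hK : ∀ m, K m = insert m (D m) := fun m => (hcut m).compl_left
  have hKc : ∀ m, IsPreconnected (K m) := fun m => (hcut m).isPreconnected_compl_left
  have hmK : ∀ m, m ∈ K m := fun m => (hcut m).notMem_left
  have hDK : ∀ m, D m ⊆ K m := fun m => hK m ▸ subset_insert _ _
  have hnest : ∀ m m', m' ∈ D m → K m' ⊆ D m := by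
    intro m m' hm'
    by_cases hm : m ∈ K m'
    · exfalso
      have hne : m ≠ m' := by
        rintro rfl
        exact (hcut m).notMem_right hm'
      have hmD : m ∈ D m' := by
        rw [hK] at hm
        exact hm.resolve_left hne
      have h1 : (D m)ᶜ ⊆ D m' :=
        (hcut m').subset_right (hcut m).symm.isPreconnected_compl_left (fun h => h hm')
          (hcut m).notMem_right hmD
      obtain ⟨x, hx, hx'⟩ := hmeet m m'
      exact disjoint_left.1 (hcut m').disjoint hx'
        (h1 (disjoint_left.1 (hcut m).disjoint hx))
    · exact (hcut m).subset_right (hKc m') hm (hmK m') hm'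
  have hdisj : ∀ m m', m ≠ m' → m' ∉ D m → m ∉ D m' → Disjoint (K m) (K m') := by
    intro m m' hne h1 h2
    have hm' : m' ∈ C m := ((hcut m).mem_or hne.symm).resolve_right h1
    have hm : m ∉ K m' := by
      rw [hK]
      rintro (h | h)
      exacts [hne h, h2 h]
    have := (hcut m).subset_left (hKc m') hm (hmK m') hm'
    exact disjoint_left.2 fun x hx hx' => hx (this hx')
  have htri : ∀ m m', ¬ Disjoint (K m) (K m') → K m ⊆ K m' ∨ K m' ⊆ K m := by
    intro m m' h
    by_cases hne : m = m'
    · exact Or.inl (hne ▸ Subset.rfl)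
    by_cases h1 : m' ∈ D m
    · exact Or.inr ((hnest _ _ h1).trans (hDK _))
    by_cases h2 : m ∈ D m'
    · exact Or.inl ((hnest _ _ h2).trans (hDK _))
    · exact absurd (hdisj _ _ hne h1 h2) h
  have hstrict : ∀ m m', K m ⊆ K m' → m ≠ m' → K m ⊆ D m' := by
    intro m m' h hne
    have := h (hmK m)
    rw [hK m'] at this
    exact hnest _ _ (this.resolve_left hne)
  -- Every point lies in a largest set `K b`.
  have hmax : ∀ v, ∃ b, v ∈ K b ∧ ∀ m, v ∈ K m → K m ⊆ K b := by
    intro v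
    by_contra! hno
    have hchain : ∀ m m', v ∈ K m → v ∈ K m' → K m ⊆ K m' ∨ K m' ⊆ K m := fun m m' h h' =>
      htri m m' (not_disjoint_iff.2 ⟨v, h, h'⟩)
    have hbig : ∀ m, v ∈ K m → ∃ m', v ∈ K m' ∧ K m ⊆ D m' := by
      intro m hm
      obtain ⟨m', hm', hnot⟩ := hno m hm
      have h1 := (hchain m m' hm hm').resolve_right hnot
      refine ⟨m', hm', hstrict m m' h1 ?_⟩
      rintro rfl
      exact hnot Subset.rfl
    set A : Set V := ⋃ m ∈ {m | v ∈ K m}, D m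
    have hKA : ∀ m, v ∈ K m → K m ⊆ A := by
      intro m hm
      obtain ⟨m', hm', h⟩ := hbig m hm
      exact h.trans (subset_biUnion_of_mem (u := D) hm')
    have hvA : v ∈ A := hKA v (hmK v) (hmK v)
    have hAo : IsOpen A := isOpen_biUnion fun m _ => (hcut m).isOpen_right
    have hAc : IsPreconnected A := by
      refine isPreconnected_of_forall v fun x hx => ?_
      obtain ⟨m, hm, hxm⟩ := mem_iUnion₂.1 hx
      exact ⟨K m, hKA m hm, hm, hDK m hxm, hKc m⟩
    have hAT : (A ∩ T).Subsingleton := by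
      rintro x ⟨hx, hxT⟩ y ⟨hy, hyT⟩
      obtain ⟨m, hm, hxm⟩ := mem_iUnion₂.1 hx
      obtain ⟨m', hm', hym⟩ := mem_iUnion₂.1 hy
      rcases hchain m m' hm hm' with h | h
      · exact hT' m' ⟨hxT, h (hDK m hxm)⟩ ⟨hyT, hDK m' hym⟩
      · exact hT' m ⟨hxT, hDK m hxm⟩ ⟨hyT, h (hDK m' hym)⟩
    -- The base points of the increasing sets `K m` converge to every boundary point of `A`.
    have hconv : ∀ b, b ∈ closure A → b ∉ A → ∀ O : Set V, IsOpen O → IsPreconnected O → b ∈ O →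
        ∃ m, v ∈ K m ∧ ∀ m', v ∈ K m' → K m ⊆ K m' → m' ∈ O := by
      intro b hb hbA O hO hOc hbO
      obtain ⟨x, hxO, hxA⟩ := mem_closure_iff.1 hb O hO hbO
      obtain ⟨m, hm, hxm⟩ := mem_iUnion₂.1 hxA
      refine ⟨m, hm, fun m' hm' hmm' => ?_⟩
      by_contra hm'O
      have hx' : x ∈ K m' := hmm' (hDK m hxm)
      rw [hK] at hx'
      have hxD : x ∈ D m' := hx'.resolve_left (fun h => hm'O (h ▸ hxO))
      exact hbA (hKA m' hm' (hDK m' ((hcut m').subset_right hOc hm'O hxO hxD hbO)))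
    have hAne : A ≠ univ := by
      rintro h
      rw [h, univ_inter] at hAT
      exact ((hT v).mono inter_subset_right).not_subsingleton hAT
    obtain ⟨b, hb, hbA⟩ : ∃ b, b ∈ closure A ∧ b ∉ A := by
      by_contra! h
      exact hAne (IsClopen.eq_univ ⟨closure_subset_iff_isClosed.1 h, hAo⟩ ⟨v, hvA⟩)
    have huniq : closure A ∩ {b}ᶜ ⊆ A := by
      rintro b' ⟨hb', hne⟩
      by_contra hbA'
      obtain ⟨O, O', hO, hO', hbO, hbO', hOO'⟩ := t2_separation (Ne.symm hne)
      obtain ⟨m, hm, h⟩ := hconv b hb hbA _ (hO.connectedComponentIn (x := b))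
        isPreconnected_connectedComponentIn (mem_connectedComponentIn hbO)
      obtain ⟨m', hm', h'⟩ := hconv b' hb' hbA' _ (hO'.connectedComponentIn (x := b'))
        isPreconnected_connectedComponentIn (mem_connectedComponentIn hbO')
      obtain ⟨n, hn, hmn, hmn'⟩ : ∃ n, v ∈ K n ∧ K m ⊆ K n ∧ K m' ⊆ K n := by
        rcases hchain m m' hm hm' with h1 | h1
        exacts [⟨m', hm', h1, Subset.rfl⟩, ⟨m, hm, Subset.rfl, h1⟩]
      exact disjoint_left.1 hOO' (connectedComponentIn_subset _ _ (h n hn hmn))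
        (connectedComponentIn_subset _ _ (h' n hn hmn'))
    -- Hence `A` is one of the sides of `b`, and it has to be the small one.
    have hvb : v ≠ b := fun h => hbA (h ▸ hvA)
    have hside : ∀ S : Set V, IsPreconnected S → b ∉ S → v ∈ S → S ⊆ A := by
      intro S hS hbS hvS
      refine hS.subset_of_closure_inter_subset hAo ⟨v, hvS, hvA⟩ ?_
      rintro x ⟨hx, hxS⟩
      exact huniq ⟨hx, fun h => hbS (h ▸ hxS)⟩
    rcases (hcut b).mem_or hvb with h | h
    · have := hside (C b) (hcut b).isConnected_left.isPreconnected (hcut b).notMem_left h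
      exact (hT b).not_subsingleton (hAT.anti (inter_subset_inter_left _ this))
    · exact hbA (hKA b (hDK b h) (hmK b))
  set B : Set V := (⋃ m, D m)ᶜ with hB
  have hBmem : ∀ b, b ∈ B ↔ ∀ m, b ∉ D m := by simp [hB]
  have hBcl : IsClosed B := (isOpen_iUnion fun m => (hcut m).isOpen_right).isClosed_compl
  have hcover : ∀ v, ∃ b ∈ B, v ∈ K b := by
    intro v
    obtain ⟨b, hvb, hb⟩ := hmax v
    refine ⟨b, (hBmem b).2 fun m hm => ?_, hvb⟩
    have h1 := hnest m b hm
    have h2 := hb m (hDK m (h1 hvb))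
    exact (hcut m).notMem_right (h1 (h2 (hmK m)))
  have hBdisj : B.PairwiseDisjoint K := fun b hb b' hb' hne =>
    hdisj b b' hne ((hBmem _).1 hb' b) ((hBmem _).1 hb b')
  have hBcount : B.Countable :=
    (hBdisj.mono fun m => hDK m).countable_of_isOpen
      (fun m _ => (hcut m).isOpen_right) (fun m _ => (hcut m).isConnected_right.nonempty)
  have : Countable B := hBcount.to_subtype
  have : LocallyCompactSpace B := hBcl.isClosedEmbedding_subtypeVal.locallyCompactSpace
  obtain ⟨b₁, hb₁, -⟩ := hcover (Classical.arbitrary V)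
  have : Nonempty B := ⟨⟨b₁, hb₁⟩⟩
  obtain ⟨b₀, hint⟩ := nonempty_interior_of_iUnion_of_closed (f := fun b : B => ({b} : Set B))
    (fun _ => isClosed_singleton) (iUnion_of_singleton B)
  have hb₀ : IsOpen ({b₀} : Set B) := by
    have h1 := (subset_singleton_iff_eq.1 (interior_subset (s := ({b₀} : Set B)))).resolve_left
      hint.ne_empty
    rw [← h1]
    exact isOpen_interior
  obtain ⟨O, hO, hOb⟩ := isOpen_induced_iff.1 hb₀
  have hb₀O : b₀.1 ∈ O := by
    have : b₀ ∈ Subtype.val ⁻¹' O := hOb ▸ mem_singleton b₀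
    exact this
  set P := connectedComponentIn O b₀.1
  have hPo : IsOpen P := hO.connectedComponentIn
  have hPc : IsPreconnected P := isPreconnected_connectedComponentIn
  have hb₀P : b₀.1 ∈ P := mem_connectedComponentIn hb₀O
  have hPK : ¬ P ⊆ K b₀.1 := by
    intro h
    have hopen : IsOpen (K b₀.1) := by
      have : K b₀.1 = D b₀.1 ∪ P := by
        refine Subset.antisymm ?_ (union_subset (hDK _) h)
        rw [hK]
        exact insert_subset (Or.inr hb₀P) subset_union_left
      rw [this]
      exact (hcut _).isOpen_right.union hPo
    have := IsClopen.eq_univ ⟨(hcut b₀.1).isOpen_left.isClosed_compl, hopen⟩ ⟨_, hmK _⟩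
    obtain ⟨x, hx⟩ := (hcut b₀.1).isConnected_left.nonempty
    have hxK : x ∈ (C b₀.1)ᶜ := by rw [this]; exact mem_univ x
    exact hxK hx
  obtain ⟨y, hyP, hyK⟩ := not_subset.1 hPK
  obtain ⟨b, hbB, hyb⟩ := hcover y
  have hbP : b ∈ P := by
    by_contra hbP
    have hyD : y ∈ D b := by
      rw [hK] at hyb
      exact hyb.resolve_left fun h => hbP (h ▸ hyP)
    exact (hBmem _).1 b₀.2 b ((hcut b).subset_right hPc hbP hyP hyD hb₀P)
  have hbO : b ∈ O := connectedComponentIn_subset _ _ hbP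
  have : (⟨b, hbB⟩ : B) ∈ Subtype.val ⁻¹' O := hbO
  rw [hOb] at this
  obtain rfl : b = b₀.1 := congrArg Subtype.val this
  exact hyK hyb

/-- Of three points, one separates the other two. -/
theorem not_triod [ConnectedSpace V] [LocallyConnectedSpace V] [T2Space V]
    [LocallyCompactSpace V] [TopologicalSpace.SeparableSpace V] {L R : V → Set V}
    (hcut : ∀ m, IsCut m (L m) (R m)) {A : V → Set V} {x y z : V} (hxy : x ≠ y) (hxz : x ≠ z)
    (hyz : y ≠ z) (hA : ∀ m, A m = L m ∨ A m = R m) (hx : y ∈ A x ∧ z ∈ A x)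
    (hy : x ∈ A y ∧ z ∈ A y) (hz : x ∈ A z ∧ y ∈ A z) : False := by
  let T : Set V := {x, y, z}
  -- The large side of `m` is the one that contains at least two of the three points.
  have key : ∀ m, ∃ C D, IsCut m C D ∧ (C ∩ T).Nontrivial ∧ (T \ C).Subsingleton := by
    have two : ∀ (C : Set V) (a b c : V), a ≠ b → a ∈ C → b ∈ C → T = {a, b, c} →
        (C ∩ T).Nontrivial ∧ (T \ C).Subsingleton := by
      intro C a b c hab ha hb hTe
      refine ⟨⟨a, ⟨ha, by simp [hTe]⟩, b, ⟨hb, by simp [hTe]⟩, hab⟩, ?_⟩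
      have : T \ C ⊆ {c} := by
        rw [hTe]
        rintro w ⟨rfl | rfl | rfl, hw⟩
        exacts [absurd ha hw, absurd hb hw, rfl]
      exact subsingleton_singleton.anti this
    have hT1 : T = {x, z, y} := by simp only [T]; rw [pair_comm]
    have hT2 : T = {y, z, x} := by simp only [T]; ext; simp; tauto
    intro m
    have hA' : ∃ D, IsCut m (A m) D := by
      rcases hA m with h | h
      · exact ⟨R m, h ▸ hcut m⟩
      · exact ⟨L m, h ▸ (hcut m).symm⟩
    obtain ⟨D, hD⟩ := hA'
    by_cases hmx : x = m
    · subst hmx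
      exact ⟨_, D, hD, two _ y z x hyz hx.1 hx.2 hT2⟩
    by_cases hmy : y = m
    · subst hmy
      exact ⟨_, D, hD, two _ x z y hxz hy.1 hy.2 hT1⟩
    by_cases hmz : z = m
    · subst hmz
      exact ⟨_, D, hD, two _ x y z hxy hz.1 hz.2 rfl⟩
    rcases (hcut m).mem_or hmx with h1 | h1 <;> rcases (hcut m).mem_or hmy with h2 | h2 <;>
      rcases (hcut m).mem_or hmz with h3 | h3
    · exact ⟨_, _, hcut m, two _ x y z hxy h1 h2 rfl⟩
    · exact ⟨_, _, hcut m, two _ x y z hxy h1 h2 rfl⟩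
    · exact ⟨_, _, hcut m, two _ x z y hxz h1 h3 hT1⟩
    · exact ⟨_, _, (hcut m).symm, two _ y z x hyz h2 h3 hT2⟩
    · exact ⟨_, _, hcut m, two _ y z x hyz h2 h3 hT2⟩
    · exact ⟨_, _, (hcut m).symm, two _ x z y hxz h1 h3 hT1⟩
    · exact ⟨_, _, (hcut m).symm, two _ x y z hxy h1 h2 rfl⟩
    · exact ⟨_, _, (hcut m).symm, two _ x y z hxy h1 h2 rfl⟩
  choose C D h1 h2 h3 using key
  exact not_forall_isCut_almost_all h1 h2 h3

end CutPoints

/-! ### A characterization of the line -/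

section Line

variable {V : Type*} [TopologicalSpace V]

/-- The sides of all cut points can be labelled left and right in a consistent way. -/
theorem exists_consistent_isCut [ConnectedSpace V] [LocallyConnectedSpace V] [T2Space V]
    [LocallyCompactSpace V] [TopologicalSpace.SeparableSpace V]
    (h : ∀ m : V, SplitsInTwo ({m}ᶜ : Set V)) :
    ∃ L R : V → Set V, (∀ m, IsCut m (L m) (R m)) ∧ (∀ x y, y ∈ R x → x ∈ L y) ∧
      ∀ x y, y ∈ L x → x ∈ R y := by
  classical
  have h' : ∀ m : V, ∃ A B : Set V, IsCut m A B := fun m => by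
    obtain ⟨A, B, hA, hB, hAc, hBc, hd, hu⟩ := h m
    exact ⟨A, B, hA, hB, hAc, hBc, hd, hu⟩
  -- Orient the sides of one point `p` arbitrarily and those of every other point according to
  -- where `p` lies.
  obtain ⟨p⟩ : Nonempty V := inferInstance
  obtain ⟨A, B, hAB⟩ := h' p
  have hor : ∀ m, ∃ L R : Set V, IsCut m L R ∧ (m = p → L = A ∧ R = B) ∧
      (m ∈ B → p ∈ L) ∧ (m ∈ A → p ∈ R) := by
    intro m
    by_cases hmp : m = p
    · subst hmp
      exact ⟨A, B, hAB, fun _ => ⟨rfl, rfl⟩, fun h => absurd h hAB.notMem_right,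
        fun h => absurd h hAB.notMem_left⟩
    · obtain ⟨C, D, hCD⟩ := h' m
      have : ∃ C D, IsCut m C D ∧ p ∈ C := by
        rcases hCD.mem_or (Ne.symm hmp) with h1 | h1
        exacts [⟨C, D, hCD, h1⟩, ⟨D, C, hCD.symm, h1⟩]
      obtain ⟨C, D, hCD, hpC⟩ := this
      rcases hAB.mem_or hmp with h1 | h1
      · exact ⟨D, C, hCD.symm, fun h => absurd h hmp,
          fun h => absurd h (disjoint_left.1 hAB.disjoint h1), fun _ => hpC⟩
      · exact ⟨C, D, hCD, fun h => absurd h hmp, fun _ => hpC,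
          fun h => absurd h (disjoint_right.1 hAB.disjoint h1)⟩
  choose L R hLR hp hB hA using hor
  -- Two points of `A` on each other's far side from `p` would form a triod with `p`, and two
  -- points on different sides of `p` cannot face each other.
  have main : ∀ (L R : V → Set V) (A B : Set V), (∀ m, IsCut m (L m) (R m)) → IsCut p A B →
      (L p = A ∧ R p = B) → (∀ m ∈ B, p ∈ L m) → (∀ m ∈ A, p ∈ R m) →
      ∀ x y, y ∈ R x → x ∈ L y := by
    intro L R A B hLR hAB hp hB hA x y hyx
    by_contra hxy
    have hne : x ≠ y := by
      rintro rfl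
      exact (hLR x).notMem_right hyx
    replace hxy : x ∈ R y := ((hLR y).mem_or hne).resolve_left hxy
    by_cases hxp : x = p
    · subst hxp
      rw [hp.2] at hyx
      exact disjoint_left.1 (hLR y).disjoint (hB y hyx) hxy
    by_cases hyp : y = p
    · subst hyp
      rw [hp.2] at hxy
      exact disjoint_left.1 (hLR x).disjoint (hB x hxy) hyx
    have mixed : ∀ x y, y ∈ R x → x ∈ B → y ∈ A → False := by
      intro x y hyx hxB hyA
      have hxA : x ∉ Bᶜ := fun h => h hxB
      have := (hLR x).subset_left hAB.symm.isPreconnected_compl_left hxA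
        hAB.notMem_right (hB x hxB)
      exact disjoint_left.1 (hLR x).disjoint (this (disjoint_left.1 hAB.disjoint hyA)) hyx
    rcases hAB.mem_or hxp with hxA | hxB <;> rcases hAB.mem_or hyp with hyA | hyB
    · refine not_triod hLR (A := fun m => if m = p then A else R m) (x := x) (y := y) (z := p)
        hne hxp hyp ?_ ?_ ?_ ?_
      · intro m
        by_cases hm : m = p
        · subst hm
          simp [hp.1]
        · simp [hm]
      · simp [hxp, hyx, hA x hxA]
      · simp [hyp, hxy, hA y hyA]
      · simp [hxA, hyA]
    · exact mixed y x hxy hyB hxA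
    · exact mixed x y hyx hxB hyA
    · have hxR : y ∉ (R x)ᶜ := fun h => h hyx
      have := (hLR y).subset_left (hLR x).symm.isPreconnected_compl_left hxR
        (disjoint_left.1 (hLR x).disjoint (hB x hxB)) (hB y hyB) (hLR x).notMem_right
      exact disjoint_left.1 (hLR y).disjoint this hxy
  refine ⟨L, R, hLR, main L R A B hLR hAB (hp p rfl) hB hA, ?_⟩
  exact main R L B A (fun m => (hLR m).symm) hAB.symm (hp p rfl).symm hA hB

/-- In a connected, locally connected space the order topology of a linear order with open rays and
without end points is the given topology: a connected neighbourhood contains with two points all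
points between them. -/
theorem orderTopology_of_isOpen_rays [ConnectedSpace V] [LocallyConnectedSpace V] [LinearOrder V]
    [NoMinOrder V] [NoMaxOrder V] (hIoi : ∀ a : V, IsOpen (Ioi a)) (hIio : ∀ a : V, IsOpen (Iio a)) :
    OrderTopology V := by
  refine ⟨le_antisymm ?_ ?_⟩
  · refine le_generateFrom ?_
    rintro s ⟨a, rfl | rfl⟩
    exacts [hIoi a, hIio a]
  · intro s hs
    rw [@isOpen_iff_forall_mem_open]
    intro x hx
    set P := connectedComponentIn s x
    have hPo : IsOpen P := hs.connectedComponentIn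
    have hPc : P.OrdConnected := by
      refine ⟨fun a ha b hb c hc => ?_⟩
      by_contra hcP
      have hcov : P ⊆ Iio c ∪ Ioi c := fun z hz => by
        rcases lt_trichotomy z c with h | rfl | h
        exacts [Or.inl h, absurd hz hcP, Or.inr h]
      have hac : a < c := lt_of_le_of_ne hc.1 fun h => hcP (h ▸ ha)
      have hcb : c < b := lt_of_le_of_ne hc.2 fun h => hcP (h ▸ hb)
      have := isPreconnected_connectedComponentIn.subset_left_of_subset_union (hIio c) (hIoi c)
        (disjoint_left.2 fun z h h' => lt_asymm h h') hcov ⟨a, ha, hac⟩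
      exact lt_asymm hcb (this hb)
    have hxP : x ∈ P := mem_connectedComponentIn hx
    -- `P` reaches beyond `x` on both sides, since no closed ray is open.
    obtain ⟨a, ha, hax⟩ : ∃ a ∈ P, a < x := by
      by_contra! hno
      have : IsOpen (Ici x) := by
        have : Ici x = Ioi x ∪ P := by
          refine Subset.antisymm (fun z hz => ?_) (union_subset Ioi_subset_Ici_self hno)
          rcases eq_or_lt_of_le hz with rfl | h
          exacts [Or.inr hxP, Or.inl h]
        rw [this]
        exact (hIoi x).union hPo
      have huniv := IsClopen.eq_univ ⟨⟨by rw [compl_Ici]; exact hIio x⟩, this⟩ ⟨x, le_refl x⟩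
      obtain ⟨y, hy⟩ := exists_lt x
      exact not_le_of_gt hy (huniv ▸ mem_univ y : y ∈ Ici x)
    obtain ⟨b, hb, hxb⟩ : ∃ b ∈ P, x < b := by
      by_contra! hno
      have : IsOpen (Iic x) := by
        have : Iic x = Iio x ∪ P := by
          refine Subset.antisymm (fun z hz => ?_) (union_subset Iio_subset_Iic_self hno)
          rcases eq_or_lt_of_le hz with rfl | h
          exacts [Or.inr hxP, Or.inl h]
        rw [this]
        exact (hIio x).union hPo
      have huniv := IsClopen.eq_univ ⟨⟨by rw [compl_Iic]; exact hIoi x⟩, this⟩ ⟨x, le_refl x⟩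
      obtain ⟨y, hy⟩ := exists_gt x
      exact not_le_of_gt hy (huniv ▸ mem_univ y : y ∈ Iic x)
    refine ⟨Ioi a ∩ Iio b, ?_, ?_, hax, hxb⟩
    · exact fun z hz => connectedComponentIn_subset _ _ (hPc.out ha hb ⟨hz.1.le, hz.2.le⟩)
    · exact TopologicalSpace.GenerateOpen.inter _ _ (.basic _ ⟨a, Or.inl rfl⟩) (.basic _ ⟨b, Or.inr rfl⟩)

/-- A separable connected order without end points is homeomorphic to the real line, by extending an
order isomorphism between a countable dense subset and the rational numbers. -/
theorem nonempty_homeomorph_real_of_orderTopology [ConnectedSpace V] [LinearOrder V]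
    [OrderTopology V] [NoMinOrder V] [NoMaxOrder V] [TopologicalSpace.SeparableSpace V] :
    Nonempty (V ≃ₜ ℝ) := by
  have hdense : DenselyOrdered V := by
    refine ⟨fun a b hab => ?_⟩
    by_contra! hno
    have h1 : Iio b = Iic a := by
      ext z
      exact ⟨fun hz => not_lt.1 fun h => not_lt_of_ge (hno z h) hz, fun hz => lt_of_le_of_lt hz hab⟩
    have huniv := IsClopen.eq_univ (s := Iio b) ⟨h1 ▸ isClosed_Iic, isOpen_Iio⟩ ⟨a, hab⟩
    exact lt_irrefl b (huniv ▸ mem_univ b : b ∈ Iio b)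
  obtain ⟨S, hSc, hS⟩ := TopologicalSpace.exists_countable_dense V
  have : Countable S := hSc.to_subtype
  have : DenselyOrdered S := ⟨fun a b hab => by
    obtain ⟨c, hc, hac, hcb⟩ := hS.exists_between hab
    exact ⟨⟨c, hc⟩, hac, hcb⟩⟩
  have : NoMinOrder S := ⟨fun a => by
    obtain ⟨c, hc, hca⟩ := hS.exists_lt a.1
    exact ⟨⟨c, hc⟩, hca⟩⟩
  have : NoMaxOrder S := ⟨fun a => by
    obtain ⟨c, hc, hca⟩ := hS.exists_gt a.1
    exact ⟨⟨c, hc⟩, hca⟩⟩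
  have : Nonempty S := hS.nonempty.to_subtype
  obtain ⟨e⟩ := Order.iso_of_countable_dense S ℚ
  let A : V → Set ℝ := fun x => (fun d : S => (e d : ℝ)) '' {d | d.1 < x}
  have hbdd : ∀ x, BddAbove (A x) := by
    intro x
    obtain ⟨c, hc, hxc⟩ := hS.exists_gt x
    refine ⟨(e ⟨c, hc⟩ : ℝ), ?_⟩
    rintro _ ⟨d, hd, rfl⟩
    have hdc : d ≤ ⟨c, hc⟩ := (lt_trans hd hxc : d.1 < c).le
    exact Rat.cast_le.2 (e.monotone hdc)
  have hne : ∀ x, (A x).Nonempty := by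
    intro x
    obtain ⟨c, hc, hxc⟩ := hS.exists_lt x
    exact ⟨_, ⟨c, hc⟩, hxc, rfl⟩
  let φ : V → ℝ := fun x => sSup (A x)
  have hle : ∀ (x : V) (d : S), d.1 < x → (e d : ℝ) ≤ φ x := fun x d hd =>
    le_csSup (hbdd x) ⟨d, hd, rfl⟩
  have hge : ∀ (x : V) (d : S), x ≤ d.1 → φ x ≤ e d := by
    intro x d hd
    refine csSup_le (hne x) ?_
    rintro _ ⟨d', hd', rfl⟩
    have hdd : d' ≤ d := (lt_of_lt_of_le hd' hd : d'.1 < d.1).le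
    exact Rat.cast_le.2 (e.monotone hdd)
  have hmono : StrictMono φ := by
    intro x y hxy
    obtain ⟨c, hc, hxc, hcy⟩ := hS.exists_between hxy
    obtain ⟨c', hc', hcc', hcy'⟩ := hS.exists_between hcy
    have h1 : (e ⟨c, hc⟩ : ℝ) < e ⟨c', hc'⟩ :=
      Rat.cast_lt.2 (e.strictMono (show (⟨c, hc⟩ : S) < ⟨c', hc'⟩ from hcc'))
    exact (hge x ⟨c, hc⟩ hxc.le).trans_lt (h1.trans_le (hle y ⟨c', hc'⟩ hcy'))
  have hrat : ∀ d : S, φ d.1 = e d := by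
    intro d
    refine le_antisymm (hge _ d le_rfl) ?_
    by_contra! hlt
    obtain ⟨r, hr, hr'⟩ := exists_rat_btwn hlt
    have h1 : (e.symm r).1 < d.1 := by
      have : e.symm r < d := by
        rw [OrderIso.symm_apply_lt]
        exact_mod_cast hr'
      exact this
    have := hle d.1 (e.symm r) h1
    rw [e.apply_symm_apply] at this
    exact not_lt_of_ge this hr
  have hQ : range ((↑) : ℚ → ℝ) ⊆ range φ := by
    rintro _ ⟨r, rfl⟩
    exact ⟨(e.symm r).1, by rw [hrat, e.apply_symm_apply]⟩
  have hcont : Continuous φ :=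
    hmono.monotone.continuous_of_denseRange (Rat.denseRange_cast.mono hQ)
  have hsurj : Function.Surjective φ := by
    intro t
    have hord := (isPreconnected_range hcont).ordConnected
    obtain ⟨r, hr⟩ := exists_rat_lt t
    obtain ⟨r', hr'⟩ := exists_rat_gt t
    exact hord.out (hQ ⟨r, rfl⟩) (hQ ⟨r', rfl⟩) ⟨hr.le, hr'.le⟩
  exact ⟨(hmono.orderIsoOfSurjective φ hsurj).toHomeomorph⟩

/-- A connected, locally connected, locally compact separable Hausdorff space in which the
complement of every point has exactly two components is homeomorphic to the real line. -/
theorem nonempty_homeomorph_real_of_splitsInTwo [ConnectedSpace V] [LocallyConnectedSpace V]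
    [T2Space V] [LocallyCompactSpace V] [TopologicalSpace.SeparableSpace V]
    (h : ∀ m : V, SplitsInTwo ({m}ᶜ : Set V)) : Nonempty (V ≃ₜ ℝ) := by
  obtain ⟨L, R, hLR, h1, h2⟩ := exists_consistent_isCut h
  have htrans : ∀ x y z, y ∈ R x → z ∈ R y → z ∈ R x := by
    intro x y z hxy hyz
    by_contra hzx
    have hyn : y ∉ (R x)ᶜ := fun h => h hxy
    have := (hLR y).subset_left (hLR x).symm.isPreconnected_compl_left hyn
      (hLR x).notMem_right (h1 x y hxy) hzx
    exact disjoint_left.1 (hLR y).disjoint this hyz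
  have hasymm : ∀ x y, y ∈ R x → x ∉ R y := fun x y hxy hyx =>
    disjoint_left.1 (hLR y).disjoint (h1 x y hxy) hyx
  let _ : LinearOrder V :=
    { le := fun x y => x = y ∨ y ∈ R x
      lt := fun x y => y ∈ R x
      le_refl := fun x => Or.inl rfl
      le_trans := by
        rintro x y z (rfl | hxy) (rfl | hyz)
        exacts [Or.inl rfl, Or.inr hyz, Or.inr hxy, Or.inr (htrans x y z hxy hyz)]
      lt_iff_le_not_ge := by
        intro x y
        constructor
        · intro hxy
          refine ⟨Or.inr hxy, ?_⟩
          rintro (rfl | hyx)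
          exacts [(hLR y).notMem_right hxy, hasymm x y hxy hyx]
        · rintro ⟨rfl | hxy, hno⟩
          exacts [absurd (Or.inl rfl) hno, hxy]
      le_antisymm := by
        rintro x y (rfl | hxy) (h | hyx)
        exacts [rfl, rfl, h.symm, absurd hyx (hasymm x y hxy)]
      le_total := by
        intro x y
        by_cases hxy : x = y
        · exact Or.inl (Or.inl hxy)
        · rcases (hLR y).mem_or hxy with h | h
          exacts [Or.inl (Or.inr (h2 y x h)), Or.inr (Or.inr h)]
      toDecidableLE := Classical.decRel _ }
  have : NoMaxOrder V := ⟨fun x => (hLR x).isConnected_right.nonempty⟩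
  have : NoMinOrder V := ⟨fun x => by
    obtain ⟨y, hy⟩ := (hLR x).isConnected_left.nonempty
    exact ⟨y, h2 x y hy⟩⟩
  have : OrderTopology V := by
    refine orderTopology_of_isOpen_rays (fun a => (hLR a).isOpen_right) fun a => ?_
    convert (hLR a).isOpen_left using 1
    ext y
    exact ⟨fun hy => h1 y a hy, fun hy => h2 a y hy⟩
  exact nonempty_homeomorph_real_of_orderTopology

end Line

/-! ### Open arcs -/

section Arcs

variable {W : Type*} [TopologicalSpace W]

/-- `A` is an open arc parametrized by `γ` on `[s, t]`: an open set of the space that is the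
injective image of the open interval `(s, t)`, while the end points `γ s` and `γ t`, which may
coincide, lie outside. -/
structure IsOpenArc (A : Set W) (γ : ℝ → W) (s t : ℝ) : Prop where
  lt : s < t
  continuousOn : ContinuousOn γ (Icc s t)
  injOn : InjOn γ (Ioo s t)
  image_eq : γ '' Ioo s t = A
  isOpen : IsOpen A
  left_notMem : γ s ∉ A
  right_notMem : γ t ∉ A

namespace IsOpenArc

variable {A : Set W} {γ : ℝ → W} {s t : ℝ}

theorem isConnected (h : IsOpenArc A γ s t) : IsConnected A := by
  rw [← h.image_eq]
  exact (isConnected_Ioo h.lt).image γ (h.continuousOn.mono Ioo_subset_Icc_self)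

theorem mem (h : IsOpenArc A γ s t) {r : ℝ} (hr : r ∈ Ioo s t) : γ r ∈ A :=
  h.image_eq ▸ mem_image_of_mem γ hr

/-- A point of the arc has only one parameter, even among those of the closed interval. -/
theorem eq_of_eq (h : IsOpenArc A γ s t) {r r' : ℝ} (hr : r ∈ Ioo s t) (hr' : r' ∈ Icc s t)
    (he : γ r = γ r') : r = r' := by
  have h1 : r' ≠ s := by
    rintro rfl
    exact h.left_notMem (he ▸ h.mem hr)
  have h2 : r' ≠ t := by
    rintro rfl
    exact h.right_notMem (he ▸ h.mem hr)
  exact h.injOn hr ⟨lt_of_le_of_ne hr'.1 h1.symm, lt_of_le_of_ne hr'.2 h2⟩ he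

theorem closure_eq [T2Space W] (h : IsOpenArc A γ s t) : closure A = A ∪ {γ s, γ t} := by
  have himg : γ '' Icc s t = A ∪ {γ s, γ t} := by
    rw [← Ioo_union_both h.lt.le, image_union, h.image_eq, image_pair]
  have hcl : IsClosed (γ '' Icc s t) := (isCompact_Icc.image_of_continuousOn h.continuousOn).isClosed
  rw [← himg]
  refine Subset.antisymm (closure_minimal (himg ▸ subset_union_left) hcl) ?_
  have := h.continuousOn
  rw [← closure_Ioo h.lt.ne] at this ⊢
  rw [← h.image_eq]
  exact this.image_closure

theorem left [T2Space W] (h : IsOpenArc A γ s t) {r : ℝ} (hr : r ∈ Ioo s t) :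
    IsOpenArc (γ '' Ioo s r) γ s r := by
  have hsub : Ioo s r ⊆ Ioo s t := Ioo_subset_Ioo_right hr.2.le
  have hsub' : γ '' Ioo s r ⊆ A := h.image_eq ▸ image_mono hsub
  refine ⟨hr.1, h.continuousOn.mono (Icc_subset_Icc_right hr.2.le), h.injOn.mono hsub, rfl, ?_,
    fun h' => h.left_notMem (hsub' h'), ?_⟩
  · have : γ '' Ioo s r = A \ γ '' Icc r t := by
      ext x
      constructor
      · rintro ⟨a, ha, rfl⟩
        refine ⟨h.mem (hsub ha), ?_⟩
        rintro ⟨b, hb, hab⟩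
        obtain rfl := h.eq_of_eq (hsub ha) ⟨hr.1.le.trans hb.1, hb.2⟩ hab.symm
        exact not_lt_of_ge hb.1 ha.2
      · rintro ⟨hx, hx'⟩
        rw [← h.image_eq] at hx
        obtain ⟨a, ha, rfl⟩ := hx
        exact ⟨a, ⟨ha.1, not_le.1 fun hra => hx' ⟨a, ⟨hra, ha.2.le⟩, rfl⟩⟩, rfl⟩
    rw [this]
    exact h.isOpen.sdiff (isCompact_Icc.image_of_continuousOn
      (h.continuousOn.mono (Icc_subset_Icc_left hr.1.le))).isClosed
  · rintro ⟨a, ha, har⟩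
    obtain rfl := h.eq_of_eq (hsub ha) ⟨hr.1.le, hr.2.le⟩ har
    exact lt_irrefl _ ha.2

theorem right [T2Space W] (h : IsOpenArc A γ s t) {r : ℝ} (hr : r ∈ Ioo s t) :
    IsOpenArc (γ '' Ioo r t) γ r t := by
  have hsub : Ioo r t ⊆ Ioo s t := Ioo_subset_Ioo_left hr.1.le
  have hsub' : γ '' Ioo r t ⊆ A := h.image_eq ▸ image_mono hsub
  refine ⟨hr.2, h.continuousOn.mono (Icc_subset_Icc_left hr.1.le), h.injOn.mono hsub, rfl, ?_, ?_,
    fun h' => h.right_notMem (hsub' h')⟩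
  · have : γ '' Ioo r t = A \ γ '' Icc s r := by
      ext x
      constructor
      · rintro ⟨a, ha, rfl⟩
        refine ⟨h.mem (hsub ha), ?_⟩
        rintro ⟨b, hb, hab⟩
        obtain rfl := h.eq_of_eq (hsub ha) ⟨hb.1, hb.2.trans hr.2.le⟩ hab.symm
        exact not_lt_of_ge hb.2 ha.1
      · rintro ⟨hx, hx'⟩
        rw [← h.image_eq] at hx
        obtain ⟨a, ha, rfl⟩ := hx
        exact ⟨a, ⟨not_le.1 fun hra => hx' ⟨a, ⟨ha.1.le, hra⟩, rfl⟩, ha.2⟩, rfl⟩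
    rw [this]
    exact h.isOpen.sdiff (isCompact_Icc.image_of_continuousOn
      (h.continuousOn.mono (Icc_subset_Icc_right hr.2.le))).isClosed
  · rintro ⟨a, ha, har⟩
    obtain rfl := h.eq_of_eq (hsub ha) ⟨hr.1.le, hr.2.le⟩ har
    exact lt_irrefl _ ha.1

theorem diff_singleton (h : IsOpenArc A γ s t) {r : ℝ} (hr : r ∈ Ioo s t) :
    γ '' Ioo s r ∪ γ '' Ioo r t = A \ {γ r} := by
  ext x
  constructor
  · rintro (⟨a, ha, rfl⟩ | ⟨a, ha, rfl⟩)
    · have ha' : a ∈ Ioo s t := ⟨ha.1, ha.2.trans hr.2⟩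
      exact ⟨h.mem ha', fun he => ha.2.ne (h.injOn ha' hr he)⟩
    · have ha' : a ∈ Ioo s t := ⟨hr.1.trans ha.1, ha.2⟩
      exact ⟨h.mem ha', fun he => ha.1.ne' (h.injOn ha' hr he)⟩
  · rintro ⟨hx, hne⟩
    rw [← h.image_eq] at hx
    obtain ⟨a, ha, rfl⟩ := hx
    have har : a ≠ r := fun har => hne (har ▸ rfl)
    rcases lt_or_gt_of_ne har with h1 | h1
    exacts [Or.inl ⟨a, ⟨ha.1, h1⟩, rfl⟩, Or.inr ⟨a, ⟨h1, ha.2⟩, rfl⟩]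

theorem isCylinder [T2Space W] (h : IsOpenArc A γ s t) : IsCylinder A := by
  refine ⟨h.isOpen, h.isConnected, fun z hz => ?_⟩
  rw [← h.image_eq] at hz
  obtain ⟨r, hr, rfl⟩ := hz
  refine ⟨_, _, (h.left hr).isOpen, (h.right hr).isOpen, (h.left hr).isConnected,
    (h.right hr).isConnected, ?_, h.diff_singleton hr⟩
  rw [disjoint_left]
  rintro _ ⟨a, ha, rfl⟩ ⟨b, hb, hab⟩
  have := h.injOn ⟨hr.1.trans hb.1, hb.2⟩ ⟨ha.1, ha.2.trans hr.2⟩ hab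
  exact lt_asymm ha.2 (this ▸ hb.1)

/-- The arc reparametrized by the unit interval. -/
theorem exists_unitInterval (h : IsOpenArc A γ s t) :
    ∃ δ : unitInterval → W, Continuous δ ∧ δ 0 = γ s ∧ δ 1 = γ t ∧ InjOn δ {0, 1}ᶜ ∧
      δ '' {0, 1}ᶜ = A := by
  have hst := sub_pos.2 h.lt
  let a : unitInterval → ℝ := fun u => s + u * (t - s)
  have ha : Continuous a := by fun_prop
  have hIcc : ∀ u, a u ∈ Icc s t := fun u => by
    have h0 := mul_nonneg u.2.1 hst.le
    have h1 := mul_le_mul_of_nonneg_right u.2.2 hst.le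
    constructor <;> simp only [a] <;> linarith
  have hIoo : ∀ u ∈ ({0, 1}ᶜ : Set unitInterval), a u ∈ Ioo s t := fun u hu => by
    rw [mem_compl_iff, mem_insert_iff, mem_singleton_iff, not_or] at hu
    have hu0 : (0 : ℝ) < u := unitInterval.pos_iff_ne_zero.2 hu.1
    have hu1 : (u : ℝ) < 1 := unitInterval.lt_one_iff_ne_one.2 hu.2
    have h0 := mul_pos hu0 hst
    have h1 := mul_lt_mul_of_pos_right hu1 hst
    constructor <;> simp only [a] <;> linarith
  refine ⟨γ ∘ a, h.continuousOn.comp_continuous ha hIcc, by simp [a], by simp [a], ?_, ?_⟩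
  · intro u hu v hv huv
    have := h.injOn (hIoo u hu) (hIoo v hv) huv
    exact Subtype.ext (mul_right_cancel₀ hst.ne' (add_left_cancel this))
  · rw [← h.image_eq, image_comp]
    congr 1
    refine Subset.antisymm (image_subset_iff.2 hIoo) fun x hx => ?_
    have hx0 : 0 < x - s := sub_pos.2 hx.1
    have hx1 : (x - s) / (t - s) < 1 := (div_lt_one hst).2 (by linarith [hx.2])
    refine ⟨⟨(x - s) / (t - s), (div_pos hx0 hst).le, hx1.le⟩, ?_, ?_⟩
    · rw [mem_compl_iff, mem_insert_iff, mem_singleton_iff, not_or]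
      exact ⟨fun he => (div_pos hx0 hst).ne' (congrArg Subtype.val he),
        fun he => hx1.ne (congrArg Subtype.val he)⟩
    · simp only [a]
      rw [div_mul_cancel₀ _ hst.ne']
      ring

end IsOpenArc

/-- An open embedding of the line in a compact, locally connected space converges at infinity: a
connected neighbourhood of a limit point cannot contain a whole bounded excursion of the line. -/
theorem Topology.IsOpenEmbedding.exists_tendsto_atTop [CompactSpace W] [T2Space W]
    [LocallyConnectedSpace W] {g : ℝ → W} (hg : IsOpenEmbedding g) :
    ∃ p ∉ range g, Tendsto g atTop (𝓝 p) := by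
  obtain ⟨p, hp⟩ := exists_clusterPt_of_compactSpace (map g atTop)
  have hfreq : ∀ N ∈ 𝓝 p, ∃ᶠ x in atTop, g x ∈ N := mapClusterPt_iff_frequently.1 hp
  have hpr : p ∉ range g := by
    rintro ⟨r, rfl⟩
    have hN : g '' Iio (r + 1) ∈ 𝓝 (g r) :=
      (hg.isOpenMap _ isOpen_Iio).mem_nhds ⟨r, lt_add_one r, rfl⟩
    obtain ⟨x, hx, y, hy, hxy⟩ := (hfreq _ hN).forall_exists_of_atTop (r + 1)
    exact not_lt_of_ge hx (hg.injective hxy ▸ hy)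
  refine ⟨p, hpr, ?_⟩
  rw [(LocallyConnectedSpace.open_connected_basis p).tendsto_right_iff]
  rintro N ⟨hNo, hpN, hNc⟩
  by_contra hno
  have hno' : ∃ᶠ x in atTop, g x ∉ N := not_eventually.1 hno
  obtain ⟨a, -, ha⟩ := hno'.forall_exists_of_atTop 0
  obtain ⟨c, hac, hc⟩ := (hfreq N (hNo.mem_nhds hpN)).forall_exists_of_atTop a
  obtain ⟨b, hcb, hb⟩ := hno'.forall_exists_of_atTop c
  have hac' : a < c := lt_of_le_of_ne hac fun h => ha (h ▸ hc)
  have hcb' : c < b := lt_of_le_of_ne hcb fun h => hb (h ▸ hc)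
  have hsub : N ⊆ g '' Ioo a b := by
    refine hNc.isPreconnected.subset_of_closure_inter_subset (hg.isOpenMap _ isOpen_Ioo)
      ⟨g c, hc, c, ⟨hac', hcb'⟩, rfl⟩ ?_
    rintro z ⟨hz, hzN⟩
    have hcl : IsClosed (g '' Icc a b) := (isCompact_Icc.image hg.continuous).isClosed
    obtain ⟨x, hx, rfl⟩ := closure_minimal (image_mono Ioo_subset_Icc_self) hcl hz
    exact ⟨x, ⟨lt_of_le_of_ne hx.1 fun h => ha (h ▸ hzN), lt_of_le_of_ne hx.2 fun h => hb (h ▸ hzN)⟩,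
      rfl⟩
  exact hpr (image_subset_range _ _ (hsub hpN))

theorem IsCylinder.exists_isOpenArc [CompactSpace W] [T2Space W] [LocallyConnectedSpace W]
    [TopologicalSpace.SeparableSpace W] {V : Set W} (h : IsCylinder V) :
    ∃ γ s t, IsOpenArc V γ s t := by
  have : ConnectedSpace V := isConnected_iff_connectedSpace.1 h.isConnected
  have : LocallyConnectedSpace V := h.isOpen.locallyConnectedSpace
  have : LocallyCompactSpace V := h.isOpen.locallyCompactSpace
  have : TopologicalSpace.SeparableSpace V := by
    obtain ⟨S, hS, hSd⟩ := TopologicalSpace.exists_countable_dense W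
    exact ⟨_, hS.preimage Subtype.val_injective, hSd.preimage h.isOpen.isOpenMap_subtype_val⟩
  have hsplit : ∀ m : V, SplitsInTwo ({m}ᶜ : Set V) := by
    intro m
    obtain ⟨A, B, hA, hB, hAc, hBc, hd, hu⟩ := h.splitsInTwo m m.2
    have hconn : ∀ P ⊆ V \ {m.1}, IsConnected P → IsConnected (Subtype.val ⁻¹' P : Set V) := by
      intro P hP hPc
      have himg : Subtype.val '' (Subtype.val ⁻¹' P : Set V) = P := by
        rw [Subtype.image_preimage_coe, inter_eq_right]
        exact hP.trans sdiff_subset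
      refine ⟨?_, IsInducing.subtypeVal.isPreconnected_image.1 (himg.symm ▸ hPc.isPreconnected)⟩
      obtain ⟨x, hx⟩ := hPc.nonempty
      exact ⟨⟨x, (hP hx).1⟩, hx⟩
    refine ⟨_, _, hA.preimage continuous_subtype_val, hB.preimage continuous_subtype_val,
      hconn A (hu ▸ subset_union_left) hAc, hconn B (hu ▸ subset_union_right) hBc,
      hd.preimage _, ?_⟩
    rw [← preimage_union, hu]
    ext x
    simp [Subtype.ext_iff]
  obtain ⟨ψ⟩ := nonempty_homeomorph_real_of_splitsInTwo hsplit
  let g : ℝ → W := fun x => ψ.symm x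
  have hg : IsOpenEmbedding g := h.isOpen.isOpenEmbedding_subtypeVal.comp ψ.symm.isOpenEmbedding
  have hrange : range g = V := by
    have : g = Subtype.val ∘ ψ.symm := rfl
    rw [this, range_comp, ψ.symm.surjective.range_eq, image_univ, Subtype.range_coe]
  obtain ⟨q, hq, hqt⟩ := hg.exists_tendsto_atTop
  have hg' : IsOpenEmbedding (fun x => g (-x)) := hg.comp (Homeomorph.neg ℝ).isOpenEmbedding
  obtain ⟨p, hp, hpt⟩ := hg'.exists_tendsto_atTop
  have hpt' : Tendsto g atBot (𝓝 p) := by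
    have := hpt.comp tendsto_neg_atBot_atTop
    simpa [Function.comp_def] using this
  have hp' : p ∉ V := by
    rw [← hrange]
    rintro ⟨x, rfl⟩
    exact hp ⟨-x, by simp⟩
  rw [hrange] at hq
  -- The tangent turns the line into a bounded interval, at whose ends the limits are filled in.
  have hlt : -(Real.pi / 2) < Real.pi / 2 := by linarith [Real.pi_pos]
  let I := Ioo (-(Real.pi / 2)) (Real.pi / 2)
  let δ : ℝ → W := fun x => g (Real.tan x)
  have hδ : ContinuousOn δ I := hg.continuous.comp_continuousOn Real.continuousOn_tan_Ioo
  have hδ1 : Tendsto δ (𝓝[>] (-(Real.pi / 2))) (𝓝 p) := hpt'.comp Real.tendsto_tan_neg_pi_div_two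
  have hδ2 : Tendsto δ (𝓝[<] (Real.pi / 2)) (𝓝 q) := hqt.comp Real.tendsto_tan_pi_div_two
  have hext : ∀ x ∈ I, extendFrom I δ x = δ x := fun x hx =>
    extendFrom_eq (subset_closure hx) (hδ x hx)
  have himg : extendFrom I δ '' I = V := by
    rw [image_congr hext, ← hrange]
    change (fun x => g (Real.tan x)) '' I = range g
    rw [← image_univ, ← Real.image_tan_Ioo, image_image]
  refine ⟨extendFrom I δ, _, _, hlt, continuousOn_Icc_extendFrom_Ioo hδ hδ1 hδ2, ?_, himg, h.isOpen,
    ?_, ?_⟩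
  · intro x hx y hy hxy
    rw [hext x hx, hext y hy] at hxy
    exact Real.injOn_tan hx hy (hg.injective hxy)
  · rwa [eq_lim_at_left_extendFrom_Ioo hlt hδ1]
  · rwa [eq_lim_at_right_extendFrom_Ioo hlt hδ2]

end Arcs

/-! ### Arc decompositions and finite graphs -/

section Decomposition

variable {W : Type*} [TopologicalSpace W]

/-- A decomposition of a space into a finite set `S` of vertices and a finite set `𝓐` of open arcs
that avoid the vertices and have their end points among them. -/
structure IsArcDecomposition (S : Set W) (𝓐 : Set (Set W)) : Prop where
  finite_vertices : S.Finite
  finite_arcs : 𝓐.Finite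
  exists_isOpenArc : ∀ A ∈ 𝓐, ∃ γ s t, IsOpenArc A γ s t ∧ γ s ∈ S ∧ γ t ∈ S
  disjoint : ∀ A ∈ 𝓐, Disjoint A S
  union_eq : S ∪ ⋃₀ 𝓐 = univ

/-- Finitely many open arcs that cover all but finitely many points can be subdivided to an arc
decomposition. -/
theorem exists_isArcDecomposition [T2Space W] {S₀ : Set W} {𝓐 : Set (Set W)} (hS₀ : S₀.Finite)
    (h𝓐 : 𝓐.Finite) (harc : ∀ A ∈ 𝓐, ∃ γ s t, IsOpenArc A γ s t) (hcov : S₀ ∪ ⋃₀ 𝓐 = univ) :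
    ∃ S 𝓑, IsArcDecomposition S 𝓑 ∧ S₀ ⊆ S := by
  have harc' : ∀ A : 𝓐, ∃ γ s t, IsOpenArc A.1 γ s t := fun A => harc A A.2
  choose γ s t hγ using harc'
  have := h𝓐.to_subtype
  set S : Set W := S₀ ∪ (range (fun A => γ A (s A)) ∪ range (fun A => γ A (t A)))
  have hSfin : S.Finite := hS₀.union ((finite_range _).union (finite_range _))
  let Good : Set W → Prop := fun A => ∃ γ s t, IsOpenArc A γ s t ∧ γ s ∈ S ∧ γ t ∈ S
  -- The vertices are removed one after the other, each time cutting the arcs through the vertex.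
  have key : ∀ F ⊆ S, F.Finite → ∃ 𝓑 : Set (Set W), 𝓑.Finite ∧ (∀ A ∈ 𝓑, Good A ∧ Disjoint A F) ∧
      F ∪ ⋃₀ 𝓐 ⊆ F ∪ ⋃₀ 𝓑 := by
    intro F hF hFfin
    induction F, hFfin using Set.Finite.induction_on with
    | empty =>
      refine ⟨𝓐, h𝓐, fun A hA => ⟨⟨γ ⟨A, hA⟩, _, _, hγ ⟨A, hA⟩, ?_, ?_⟩, disjoint_empty _⟩,
        Subset.rfl⟩
      exacts [Or.inr (Or.inl ⟨_, rfl⟩), Or.inr (Or.inr ⟨_, rfl⟩)]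
    | @insert p F _ _ ih =>
      obtain ⟨𝓑, h𝓑, hgood, hsub⟩ := ih ((subset_insert p F).trans hF)
      have hpS : p ∈ S := hF (mem_insert p F)
      have hcut : ∀ A ∈ 𝓑, ∃ 𝓒 : Set (Set W), 𝓒.Finite ∧ (∀ C ∈ 𝓒, Good C ∧ C ⊆ A ∧ p ∉ C) ∧
          A ⊆ insert p (⋃₀ 𝓒) := by
        intro A hA
        by_cases hpA : p ∈ A
        · obtain ⟨γ, s, t, hγ, hs, ht⟩ := (hgood A hA).1
          obtain ⟨r, hr, rfl⟩ : p ∈ γ '' Ioo s t := hγ.image_eq.symm ▸ hpA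
          have hd := hγ.diff_singleton hr
          refine ⟨{γ '' Ioo s r, γ '' Ioo r t}, toFinite _, ?_, ?_⟩
          · rintro C (rfl | rfl)
            · refine ⟨⟨γ, s, r, hγ.left hr, hs, hpS⟩, ?_, (hγ.left hr).right_notMem⟩
              exact (subset_union_left.trans hd.subset).trans sdiff_subset
            · refine ⟨⟨γ, r, t, hγ.right hr, hpS, ht⟩, ?_, (hγ.right hr).left_notMem⟩
              exact (subset_union_right.trans hd.subset).trans sdiff_subset
          · rw [sUnion_pair, hd, insert_sdiff_singleton]
            exact subset_insert _ _
        · refine ⟨{A}, finite_singleton A, ?_, ?_⟩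
          · rintro C rfl
            exact ⟨(hgood _ hA).1, Subset.rfl, hpA⟩
          · rw [sUnion_singleton]
            exact subset_insert _ _
      choose! 𝓒 h𝓒 hgood' hsub' using hcut
      refine ⟨⋃ A ∈ 𝓑, 𝓒 A, h𝓑.biUnion h𝓒, ?_, ?_⟩
      · intro C hC
        obtain ⟨A, hA, hCA⟩ := mem_iUnion₂.1 hC
        obtain ⟨h1, h2, h3⟩ := hgood' A hA C hCA
        exact ⟨h1, disjoint_insert_right.2 ⟨h3, (hgood A hA).2.mono_left h2⟩⟩
      · rintro x (hx | hx)
        · exact Or.inl hx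
        rcases hsub (Or.inr hx) with hx | ⟨A, hA, hxA⟩
        · exact Or.inl (Or.inr hx)
        · rcases hsub' A hA hxA with rfl | ⟨C, hC, hxC⟩
          · exact Or.inl (Or.inl rfl)
          · exact Or.inr ⟨C, mem_iUnion₂.2 ⟨A, hA, hC⟩, hxC⟩
  obtain ⟨𝓑, h𝓑, hgood, hsub⟩ := key S Subset.rfl hSfin
  refine ⟨S, 𝓑, ⟨hSfin, h𝓑, fun A hA => (hgood A hA).1, fun A hA => (hgood A hA).2, ?_⟩,
    subset_union_left⟩
  refine univ_subset_iff.1 (Subset.trans ?_ hsub)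
  rw [← hcov]
  exact union_subset_union_left _ subset_union_left

namespace IsArcDecomposition

variable {S : Set W} {𝓐 : Set (Set W)}

theorem closure_subset [T2Space W] (h : IsArcDecomposition S 𝓐) {A : Set W} (hA : A ∈ 𝓐) :
    closure A ⊆ A ∪ S := by
  obtain ⟨γ, s, t, hγ, hs, ht⟩ := h.exists_isOpenArc A hA
  rw [hγ.closure_eq]
  exact union_subset_union_right _ (pair_subset hs ht)

theorem subset_of_not_disjoint [T2Space W] (h : IsArcDecomposition S 𝓐) {A B : Set W} (hA : A ∈ 𝓐)
    (hB : B ∈ 𝓐) (hAB : ¬ Disjoint A B) : A ⊆ B := by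
  obtain ⟨γ, s, t, hγ, -⟩ := h.exists_isOpenArc A hA
  obtain ⟨γ', s', t', hγ', -⟩ := h.exists_isOpenArc B hB
  refine hγ.isConnected.isPreconnected.subset_of_closure_inter_subset hγ'.isOpen
    (not_disjoint_iff_nonempty_inter.1 hAB) ?_
  rintro x ⟨hxB, hxA⟩
  exact (h.closure_subset hB hxB).resolve_right (disjoint_left.1 (h.disjoint A hA) hxA)

theorem pairwiseDisjoint [T2Space W] (h : IsArcDecomposition S 𝓐) : 𝓐.PairwiseDisjoint id := by
  intro A hA B hB hne
  by_contra hAB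
  exact hne ((h.subset_of_not_disjoint hA hB hAB).antisymm
    (h.subset_of_not_disjoint hB hA fun h' => hAB h'.symm))

/-- A vertex together with the arcs ending at it is a connected open set; a loop counts once. -/
theorem exists_star [T2Space W] (h : IsArcDecomposition S 𝓐) {w : W} (hw : w ∈ S) :
    ∃ U : Set W, IsOpen U ∧ IsConnected U ∧ w ∈ U ∧ ∃ 𝓑 ⊆ 𝓐, U \ {w} = ⋃₀ 𝓑 := by
  set 𝓑 : Set (Set W) := {A ∈ 𝓐 | w ∈ closure A}
  have hwA : ∀ A ∈ 𝓐, w ∉ A := fun A hA => disjoint_right.1 (h.disjoint A hA) hw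
  refine ⟨insert w (⋃₀ 𝓑), ?_, ⟨⟨w, mem_insert _ _⟩, ?_⟩, mem_insert _ _, 𝓑, sep_subset _ _, ?_⟩
  · have hcompl : (insert w (⋃₀ 𝓑))ᶜ = (S \ {w}) ∪ ⋃ A ∈ 𝓐 \ 𝓑, closure A := by
      ext x
      constructor
      · intro hx
        rw [mem_compl_iff, mem_insert_iff, not_or] at hx
        rcases (h.union_eq ▸ mem_univ x : x ∈ S ∪ ⋃₀ 𝓐) with hxS | ⟨A, hA, hxA⟩
        · exact Or.inl ⟨hxS, hx.1⟩
        · exact Or.inr (mem_iUnion₂.2 ⟨A, ⟨hA, fun hA' => hx.2 ⟨A, hA', hxA⟩⟩, subset_closure hxA⟩)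
      · have hS' : S \ {w} ⊆ (insert w (⋃₀ 𝓑))ᶜ := by
          rintro x ⟨hxS, hxw⟩ (hx | ⟨A, hA, hxA⟩)
          exacts [hxw hx, disjoint_left.1 (h.disjoint A hA.1) hxA hxS]
        rintro (hx | hx)
        · exact hS' hx
        · obtain ⟨A, ⟨hA, hAB⟩, hxA⟩ := mem_iUnion₂.1 hx
          have hwcl : w ∉ closure A := fun hwA => hAB ⟨hA, hwA⟩
          have hxw : x ≠ w := fun hxw => hwcl (hxw ▸ hxA)
          rcases h.closure_subset hA hxA with hx' | hx'
          · rintro (hx | ⟨B, hB, hxB⟩)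
            · exact hxw hx
            · obtain rfl := h.pairwiseDisjoint.elim hA hB.1 (not_disjoint_iff.2 ⟨x, hx', hxB⟩)
              exact hAB hB
          · exact hS' ⟨hx', hxw⟩
    rw [← isClosed_compl_iff, hcompl]
    refine (h.finite_vertices.subset sdiff_subset).isClosed.union ?_
    exact (h.finite_arcs.subset sdiff_subset).isClosed_biUnion fun A _ => isClosed_closure
  · refine isPreconnected_of_forall w ?_
    rintro x (rfl | ⟨A, hA, hxA⟩)
    · exact ⟨{x}, singleton_subset_iff.2 (mem_insert _ _), rfl, rfl, isPreconnected_singleton⟩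
    · obtain ⟨γ, s, t, hγ, -⟩ := h.exists_isOpenArc A hA.1
      refine ⟨insert w A, insert_subset_insert (subset_sUnion_of_mem hA), mem_insert _ _,
        Or.inr hxA, ?_⟩
      exact hγ.isConnected.isPreconnected.subset_closure (subset_insert _ _)
        (insert_subset hA.2 subset_closure)
  · rw [insert_sdiff_of_mem _ (mem_singleton w), sdiff_singleton_eq_self]
    rintro ⟨A, hA, hwA'⟩
    exact hwA A hA.1 hwA'

open FiniteMultigraph in
/-- The parametrizations of the arcs map the realization of the multigraph of end points bijectively,
hence by compactness homeomorphically, onto the space. -/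
theorem hasFiniteGraphStructure [CompactSpace W] [T2Space W] (h : IsArcDecomposition S 𝓐) :
    HasFiniteGraphStructure W := by
  have harc : ∀ A : 𝓐, ∃ (δ : unitInterval → W) (a b : S), Continuous δ ∧ δ 0 = a ∧ δ 1 = b ∧
      InjOn δ {0, 1}ᶜ ∧ δ '' {0, 1}ᶜ = A := by
    intro A
    obtain ⟨γ, s, t, hγ, hs, ht⟩ := h.exists_isOpenArc A A.2
    obtain ⟨δ, h1, h2, h3, h4, h5⟩ := hγ.exists_unitInterval
    exact ⟨δ, ⟨_, hs⟩, ⟨_, ht⟩, h1, h2, h3, h4, h5⟩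
  choose δ a b hδ hδ0 hδ1 hinj himg using harc
  have := h.finite_vertices.to_subtype
  have := h.finite_arcs.to_subtype
  let eS := Finite.equivFin S
  let eA := Finite.equivFin 𝓐
  let G : FiniteMultigraph := ⟨Nat.card S, Nat.card 𝓐, fun e => eS (a (eA.symm e)),
    fun e => eS (b (eA.symm e))⟩
  let Φ : G.Pieces → W := Sum.elim (fun i => (eS.symm i : W)) fun x => δ (eA.symm x.1) x.2
  have hΦ : Continuous Φ := by
    refine Continuous.sumElim continuous_of_discreteTopology ?_
    exact continuous_prod_of_discrete_left.2 fun e => hδ (eA.symm e)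
  have hglue : ∀ x y, G.Glue x y → Φ x = Φ y := by
    rintro _ _ (e | e)
    · change δ (eA.symm e) 0 = (eS.symm (eS (a (eA.symm e))) : W)
      rw [hδ0, Equiv.symm_apply_apply]
    · change δ (eA.symm e) 1 = (eS.symm (eS (b (eA.symm e))) : W)
      rw [hδ1, Equiv.symm_apply_apply]
  let Ψ : G.Realization → W := Quot.lift Φ hglue
  have hΨ : Continuous Ψ := continuous_quot_lift hglue hΦ
  -- Every point of the realization is a vertex or an interior point of an edge.
  have hnf : ∀ x : G.Realization, (∃ i, x = Quot.mk _ (Sum.inl i)) ∨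
      ∃ e, ∃ u ∈ ({0, 1}ᶜ : Set unitInterval), x = Quot.mk _ (Sum.inr (e, u)) := by
    rintro ⟨i | ⟨e, u⟩⟩
    · exact Or.inl ⟨i, rfl⟩
    · by_cases h0 : u = 0
      · subst h0
        exact Or.inl ⟨_, Quot.sound (Glue.src e)⟩
      by_cases h1 : u = 1
      · subst h1
        exact Or.inl ⟨_, Quot.sound (Glue.tgt e)⟩
      · exact Or.inr ⟨e, u, by simp [h0, h1], rfl⟩
  have hmem : ∀ e, ∀ u ∈ ({0, 1}ᶜ : Set unitInterval), δ (eA.symm e) u ∈ (eA.symm e : Set W) :=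
    fun e u hu => himg (eA.symm e) ▸ mem_image_of_mem _ hu
  have hdisj : ∀ i e, ∀ u ∈ ({0, 1}ᶜ : Set unitInterval), (eS.symm i : W) ≠ δ (eA.symm e) u := by
    intro i e u hu he
    exact disjoint_left.1 (h.disjoint _ (eA.symm e).2) (hmem e u hu) (he ▸ (eS.symm i).2)
  have hbij : Function.Bijective Ψ := by
    constructor
    · intro x y hxy
      rcases hnf x with ⟨i, rfl⟩ | ⟨e, u, hu, rfl⟩ <;> rcases hnf y with ⟨j, rfl⟩ | ⟨e', v, hv, rfl⟩
      · rw [eS.symm.injective (Subtype.ext hxy)]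
      · exact absurd hxy (hdisj i e' v hv)
      · exact absurd hxy.symm (hdisj j e u hu)
      · replace hxy : δ (eA.symm e) u = δ (eA.symm e') v := hxy
        have he : eA.symm e = eA.symm e' := Subtype.ext <| h.pairwiseDisjoint.elim (eA.symm e).2
          (eA.symm e').2 (not_disjoint_iff.2 ⟨_, hmem e u hu, hxy ▸ hmem e' v hv⟩)
        obtain rfl := eA.symm.injective he
        rw [hinj _ hu hv hxy]
    · intro w
      rcases (h.union_eq ▸ mem_univ w : w ∈ S ∪ ⋃₀ 𝓐) with hw | ⟨A, hA, hw⟩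
      · refine ⟨Quot.mk _ (Sum.inl (eS ⟨w, hw⟩)), ?_⟩
        change (eS.symm (eS ⟨w, hw⟩) : W) = w
        rw [Equiv.symm_apply_apply]
      · obtain ⟨u, -, hu⟩ : w ∈ δ ⟨A, hA⟩ '' {0, 1}ᶜ := (himg ⟨A, hA⟩).symm ▸ hw
        refine ⟨Quot.mk _ (Sum.inr (eA ⟨A, hA⟩, u)), ?_⟩
        change δ (eA.symm (eA ⟨A, hA⟩)) u = w
        rw [Equiv.symm_apply_apply, hu]
  exact ⟨G, ⟨(Continuous.homeoOfEquivCompactToT2 (f := Equiv.ofBijective Ψ hbij) hΨ).symm⟩⟩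

end IsArcDecomposition

open FiniteMultigraph in
/-- An interior point of an edge is identified with no other point. -/
theorem FiniteMultigraph.eq_of_mk_eq_mk {G : FiniteMultigraph} {e : Fin G.numEdges}
    {u : unitInterval} (hu0 : u ≠ 0) (hu1 : u ≠ 1) {y : G.Pieces}
    (h : (Quot.mk G.Glue (Sum.inr (e, u)) : G.Realization) = Quot.mk G.Glue y) :
    y = Sum.inr (e, u) := by
  let P : G.Realization → Prop := Quot.lift (fun x => x = Sum.inr (e, u)) (by
    rintro _ _ (e' | e') <;> simp [hu0.symm, hu1.symm])
  have h1 : P (Quot.mk G.Glue (Sum.inr (e, u))) := rfl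
  rw [h] at h1
  exact h1

open FiniteMultigraph in
theorem HasFiniteGraphStructure.exists_isArcDecomposition [T2Space W]
    (h : HasFiniteGraphStructure W) : ∃ (S : Set W) (𝓐 : Set (Set W)), IsArcDecomposition S 𝓐 := by
  obtain ⟨G, ⟨φ⟩⟩ := h
  let mk : G.Pieces → G.Realization := Quot.mk G.Glue
  have hmk : IsQuotientMap mk := isQuotientMap_quot_mk
  let vert : Fin G.numVertices → W := fun i => φ.symm (mk (Sum.inl i))
  let γ : Fin G.numEdges → ℝ → W := fun e x =>
    φ.symm (mk (Sum.inr (e, projIcc 0 1 zero_le_one x)))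
  have hγ : ∀ e, Continuous (γ e) := fun e => φ.symm.continuous.comp <| hmk.continuous.comp <|
    continuous_inr.comp <| continuous_const.prodMk continuous_projIcc
  have hne0 : ∀ x ∈ Ioo (0 : ℝ) 1, projIcc (0 : ℝ) 1 zero_le_one x ≠ 0 := by
    intro x hx he
    rw [projIcc_of_mem zero_le_one ⟨hx.1.le, hx.2.le⟩] at he
    exact hx.1.ne' (congrArg Subtype.val he)
  have hne1 : ∀ x ∈ Ioo (0 : ℝ) 1, projIcc (0 : ℝ) 1 zero_le_one x ≠ 1 := by
    intro x hx he
    rw [projIcc_of_mem zero_le_one ⟨hx.1.le, hx.2.le⟩] at he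
    exact hx.2.ne (congrArg Subtype.val he)
  have hγ0 : ∀ e, γ e 0 = vert (G.src e) := by
    intro e
    have : projIcc (0 : ℝ) 1 zero_le_one 0 = 0 := projIcc_left zero_le_one
    simp only [γ, vert, this]
    exact congrArg φ.symm (Quot.sound (Glue.src e))
  have hγ1 : ∀ e, γ e 1 = vert (G.tgt e) := by
    intro e
    have : projIcc (0 : ℝ) 1 zero_le_one 1 = 1 := projIcc_right zero_le_one
    simp only [γ, vert, this]
    exact congrArg φ.symm (Quot.sound (Glue.tgt e))
  have hdisj : ∀ e i, vert i ∉ γ e '' Ioo 0 1 := by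
    rintro e i ⟨x, hx, hxi⟩
    have := eq_of_mk_eq_mk (hne0 x hx) (hne1 x hx) (φ.symm.injective hxi)
    cases this
  have harc : ∀ e, IsOpenArc (γ e '' Ioo 0 1) (γ e) 0 1 := by
    intro e
    refine ⟨zero_lt_one, (hγ e).continuousOn, ?_, rfl, ?_, hγ0 e ▸ hdisj e _, hγ1 e ▸ hdisj e _⟩
    · intro x hx y hy hxy
      have := eq_of_mk_eq_mk (hne0 x hx) (hne1 x hx) (φ.symm.injective hxy)
      have h2 := (Prod.mk.inj (Sum.inr.inj this)).2
      rw [projIcc_of_mem zero_le_one ⟨hx.1.le, hx.2.le⟩,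
        projIcc_of_mem zero_le_one ⟨hy.1.le, hy.2.le⟩] at h2
      exact (congrArg Subtype.val h2).symm
    · have himg : γ e '' Ioo 0 1 = φ ⁻¹' (mk '' (Sum.inr '' ({e} ×ˢ (Subtype.val ⁻¹' Ioo 0 1)))) := by
        ext w
        constructor
        · rintro ⟨x, hx, rfl⟩
          refine ⟨_, ⟨(e, projIcc 0 1 zero_le_one x), ⟨rfl, ?_⟩, rfl⟩, (φ.apply_symm_apply _).symm⟩
          rw [projIcc_of_mem zero_le_one ⟨hx.1.le, hx.2.le⟩]
          exact hx
        · rintro ⟨_, ⟨⟨e', u⟩, ⟨he, hu⟩, rfl⟩, hw⟩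
          obtain rfl : e' = e := he
          refine ⟨u, hu, ?_⟩
          simp only [γ, projIcc_val]
          rw [hw, φ.symm_apply_apply]
      rw [himg]
      refine IsOpen.preimage φ.continuous ?_
      rw [← hmk.isOpen_preimage]
      -- The interior of an edge is saturated for the gluing.
      have hsat : mk ⁻¹' (mk '' (Sum.inr '' ({e} ×ˢ (Subtype.val ⁻¹' Ioo 0 1)))) =
          Sum.inr '' ({e} ×ˢ (Subtype.val ⁻¹' Ioo (0 : ℝ) 1)) := by
        refine Subset.antisymm ?_ (subset_preimage_image _ _)
        rintro y ⟨_, ⟨⟨e', u⟩, hu, rfl⟩, hy⟩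
        have hu0 : u ≠ 0 := fun h0 => hu.2.1.ne' (congrArg Subtype.val h0)
        have hu1 : u ≠ 1 := fun h1 => hu.2.2.ne (congrArg Subtype.val h1)
        rw [eq_of_mk_eq_mk hu0 hu1 hy]
        exact ⟨_, hu, rfl⟩
      rw [hsat]
      exact isOpenMap_inr _ ((isOpen_discrete _).prod (isOpen_Ioo.preimage continuous_subtype_val))
  refine ⟨range vert, range fun e => γ e '' Ioo 0 1, finite_range _, finite_range _, ?_, ?_, ?_⟩
  · rintro _ ⟨e, rfl⟩
    exact ⟨γ e, 0, 1, harc e, ⟨_, (hγ0 e).symm⟩, ⟨_, (hγ1 e).symm⟩⟩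
  · rintro _ ⟨e, rfl⟩
    rw [disjoint_right]
    rintro _ ⟨i, rfl⟩
    exact hdisj e i
  · refine eq_univ_of_forall fun w => ?_
    obtain ⟨x, hx⟩ := hmk.surjective (φ w)
    have hw : w = φ.symm (mk x) := by rw [hx, φ.symm_apply_apply]
    rcases x with i | ⟨e, u⟩
    · exact Or.inl ⟨i, hw.symm⟩
    · have hwγ : w = γ e u := by simp only [γ, projIcc_val, hw]
      rcases eq_or_lt_of_le u.2.1 with h0 | h0
      · refine Or.inl ⟨G.src e, ?_⟩
        rw [hwγ, ← hγ0, ← h0]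
      · rcases eq_or_lt_of_le u.2.2 with h1 | h1
        · refine Or.inl ⟨G.tgt e, ?_⟩
          rw [hwγ, ← hγ1, h1]
        · exact Or.inr ⟨_, ⟨e, rfl⟩, hwγ ▸ ⟨u, ⟨h0, h1⟩, rfl⟩⟩

end Decomposition

/-! ### Star-like sets -/

section Reeb

variable {X : Type*} [TopologicalSpace X] {f : X → ℝ}

theorem locallyConnectedSpace_reebSpace [LocallyConnectedSpace X] :
    LocallyConnectedSpace (ReebSpace f) :=
  (isQuotientMap_reebMk (f := f)).isCoinducing.locallyConnectedSpace

theorem IsCylindrical.exists_isCylinder [LocallyConnectedSpace X] [T1Space (ReebSpace f)]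
    {U : Set X} (h : IsCylindrical f U) :
    ∃ V : Set (ReebSpace f), IsCylinder V ∧ U = reebMk f ⁻¹' V := by
  obtain ⟨V, rfl⟩ := h.saturated.exists_eq_preimage
  exact ⟨V, isCylindrical_reebMk_preimage.1 h, rfl⟩

/-- By compactness finitely many star-like sets cover the space; their cylindrical parts are open
arcs of the Reeb space that cover all of it but finitely many centres. -/
theorem hasFiniteGraphStructure_of_isStarLike [CompactSpace X] [LocallyConnectedSpace X]
    [T2Space X] [TopologicalSpace.SeparableSpace X] (hf : Continuous f)
    (h : ∀ C : Set X, IsContour f C → ∃ U : Set X, C ⊆ U ∧ IsStarLike f U) :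
    HasFiniteGraphStructure (ReebSpace f) := by
  have := t2Space_reebSpace hf
  have := locallyConnectedSpace_reebSpace (f := f)
  have hsep : TopologicalSpace.SeparableSpace (ReebSpace f) :=
    (isQuotientMap_reebMk (f := f)).surjective.denseRange.separableSpace
      isQuotientMap_reebMk.continuous
  have hcov : ∀ x : X, ∃ U : Set X, x ∈ U ∧ IsStarLike f U := by
    intro x
    obtain ⟨U, hU, hstar⟩ := h _ ⟨x, rfl⟩
    exact ⟨U, hU (mem_connectedComponentIn rfl), hstar⟩
  choose U hxU hU using hcov
  have hUo : ∀ x, IsOpen (U x) := fun x => by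
    obtain ⟨L, hL⟩ := hU x
    exact hL.isOpen
  obtain ⟨F, hF⟩ := isCompact_univ.elim_finite_subcover U hUo fun x _ =>
    mem_iUnion.2 ⟨x, hxU x⟩
  have hstar : ∀ x, ∃ (w : ReebSpace f) (𝓐 : Set (Set (ReebSpace f))), 𝓐.Finite ∧
      (∀ A ∈ 𝓐, IsCylinder A) ∧ ∀ y ∈ U x, reebMk f y = w ∨ reebMk f y ∈ ⋃₀ 𝓐 := by
    intro x
    obtain ⟨L, hL⟩ := hU x
    obtain ⟨w, rfl⟩ := isContour_iff.1 hL.isContour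
    obtain ⟨𝓥, hfin, hcyl, -, hdiff⟩ := hL.diff_eq
    refine ⟨w, image (reebMk f) '' 𝓥, hfin.image _, ?_, ?_⟩
    · rintro _ ⟨V, hV, rfl⟩
      obtain ⟨A, hA, rfl⟩ := (hcyl V hV).exists_isCylinder
      rwa [image_preimage_eq _ isQuotientMap_reebMk.surjective]
    · intro y hy
      by_cases hyw : reebMk f y = w
      · exact Or.inl hyw
      · have hy' : y ∈ U x \ reebMk f ⁻¹' {w} := ⟨hy, hyw⟩
        rw [hdiff] at hy'
        obtain ⟨V, hV, hyV⟩ := hy'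
        exact Or.inr ⟨_, ⟨V, hV, rfl⟩, y, hyV, rfl⟩
  choose w 𝓐 hfin hcyl hw using hstar
  have harc : ∀ A ∈ ⋃ x ∈ F, 𝓐 x, ∃ γ s t, IsOpenArc A γ s t := by
    intro A hA
    obtain ⟨x, -, hxA⟩ := mem_iUnion₂.1 hA
    exact (hcyl x A hxA).exists_isOpenArc
  have huniv : w '' F ∪ ⋃₀ (⋃ x ∈ F, 𝓐 x) = univ := by
    refine eq_univ_of_forall fun v => ?_
    obtain ⟨y, rfl⟩ := (isQuotientMap_reebMk (f := f)).surjective v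
    obtain ⟨x, hx, hy⟩ := mem_iUnion₂.1 (hF (mem_univ y))
    rcases hw x y hy with h' | ⟨A, hA, hyA⟩
    · exact Or.inl ⟨x, hx, h'.symm⟩
    · exact Or.inr ⟨A, mem_iUnion₂.2 ⟨x, hx, hA⟩, hyA⟩
  obtain ⟨S, 𝓑, hdec, -⟩ := exists_isArcDecomposition (F.finite_toSet.image w)
    (F.finite_toSet.biUnion fun x _ => hfin x) harc huniv
  exact hdec.hasFiniteGraphStructure

/-- After adding the given contour to the vertices of the graph, the vertex together with the arcs
ending at it is the required star. -/
theorem exists_isStarLikeAbout_of_hasFiniteGraphStructure [CompactSpace X]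
    [LocallyConnectedSpace X] [T2Space X] (hf : Continuous f)
    (h : HasFiniteGraphStructure (ReebSpace f)) {C : Set X} (hC : IsContour f C) :
    ∃ U : Set X, IsStarLikeAbout f C U := by
  have := t2Space_reebSpace hf
  obtain ⟨w, rfl⟩ := isContour_iff.1 hC
  obtain ⟨S₀, 𝓐, hdec⟩ := h.exists_isArcDecomposition
  obtain ⟨S, 𝓑, hdec', hS⟩ := exists_isArcDecomposition (S₀ := insert w S₀)
    (hdec.finite_vertices.insert w) hdec.finite_arcs
    (fun A hA => by
      obtain ⟨γ, s, t, hγ, -⟩ := hdec.exists_isOpenArc A hA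
      exact ⟨γ, s, t, hγ⟩)
    (by rw [insert_union, hdec.union_eq, insert_eq_of_mem (mem_univ w)])
  obtain ⟨U, hUo, hUc, hwU, 𝓒, h𝓒, hdiff⟩ := hdec'.exists_star (hS (mem_insert w S₀))
  refine ⟨reebMk f ⁻¹' U, isOpen_reebMk_preimage.2 hUo, (isConnected_reebMk_preimage hUo).2 hUc,
    isReebSaturated_preimage U, hC, preimage_mono (singleton_subset_iff.2 hwU),
    preimage (reebMk f) '' 𝓒, (hdec'.finite_arcs.subset h𝓒).image _, ?_, ?_, ?_⟩
  · rintro _ ⟨A, hA, rfl⟩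
    obtain ⟨γ, s, t, hγ, -⟩ := hdec'.exists_isOpenArc A (h𝓒 hA)
    exact isCylindrical_reebMk_preimage.2 hγ.isCylinder
  · rintro _ ⟨A, hA, rfl⟩ _ ⟨B, hB, rfl⟩ hne
    exact (hdec'.pairwiseDisjoint (h𝓒 hA) (h𝓒 hB) fun hAB => hne (hAB ▸ rfl)).preimage _
  · rw [← preimage_sdiff, hdiff, preimage_sUnion, sUnion_image]

end Reeb

theorem theorem3 {X : Type*} [TopologicalSpace X] [CompactSpace X] [ConnectedSpace X]
    [LocallyConnectedSpace X] [T2Space X] [SecondCountableTopology X]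
    (f : X → ℝ) (hf : Continuous f) :
    (HasFiniteGraphStructure (ReebSpace f) ↔
      ∀ C : Set X, IsContour f C → ∃ U : Set X, C ⊆ U ∧ IsStarLike f U) ∧
    (HasFiniteGraphStructure (ReebSpace f) ↔
      ∀ C : Set X, IsContour f C → ∃ U : Set X, IsStarLikeAbout f C U) := by
  have hstar : HasFiniteGraphStructure (ReebSpace f) →
      ∀ C : Set X, IsContour f C → ∃ U : Set X, IsStarLikeAbout f C U :=
    fun h C hC => exists_isStarLikeAbout_of_hasFiniteGraphStructure hf h hC
  have hweak : (∀ C : Set X, IsContour f C → ∃ U : Set X, IsStarLikeAbout f C U) →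
      ∀ C : Set X, IsContour f C → ∃ U : Set X, C ⊆ U ∧ IsStarLike f U := fun h C hC => by
    obtain ⟨U, hU⟩ := h C hC
    exact ⟨U, hU.subset, C, hU⟩
  exact ⟨⟨fun h => hweak (hstar h), hasFiniteGraphStructure_of_isStarLike hf⟩,
    ⟨hstar, fun h => hasFiniteGraphStructure_of_isStarLike hf (hweak h)⟩⟩
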